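/- **Setting.** Fix a rank $d$, put $\eta=(d-1)/4$ and $p^{2\eta}=\sum_{i=1}^d|p_i|^{2\eta}$ for $p\in\mathbb Z^d$, let $\Lambda$ be an ultraviolet cutoff, and let $\mu=\bar m^{2\eta}=m^{2\eta}/\Lambda^{2\eta}$ be the dimensionless bare mass parameter (a real number). Consider the quartic melonic tensor model with propagator $C(p)=\Theta(\Lambda^{2\eta}-p^{2\eta})/(p^{2\eta}+m^{2\eta})$ and with rescaled coupling $\lambda=g/(d\,\iota(d))$, $g>0$, where $\iota(d)=\int_{\mathbb R^{d-1}}\delta\big(1-\sum_i|x_i|^{2\eta}\big)\,dx=2^{d-1}\,\Gamma\big(\tfrac{d+1}{d-1}\big)^{d-1}$. Its melonic self energy is $\Sigma(p)=\sum_{c=1}^d\tau(p_c)$, where $\tau(p)=\sum_T(-2\lambda)^{n(T)}\mathcal A_T(p)$ is the sum over all plane rooted trees $T$ with edges (the root edge included) coloured by $\{1,\dots,d\}$ and with root edge of a fixed colour (the melonic 1PI two-point diagrams in the intermediate field representation); $n(T)$ is the number of loop vertices of $T$, and $\mathcal A_T(p)$ is the Feynman amplitude: one sums over a momentum in $\mathbb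 Z^d$ for each loop vertex, a loop vertex with $m$ edges (root edge included) carries $C^m$, an edge of colour $c$ identifies the components of colour $c$ at its two ends, and the root edge fixes its component to be $p$. With $\bar\tau=\tau/\Lambda^{2\eta}$, the dimensionless melonic effective mass is $u_{d,\Lambda}=\bar m^{2\eta}-d\,\bar\tau(0)$. Let $\omega'(x)=1-x\ln\frac{1+x}{x}$ (for $x>0$ or $x<-1$), let $W_0\ge-1$ and $W_{-1}\le-1$ be the real branches of the Lambert function, $W(x)e^{W(x)}=x$, and let $$\Delta=-\Big(\frac{\mu}{2g}+1\Big)e^{-\frac{1+\mu+2g}{2g}},\qquad u^\star=\Big(\exp\Big[-W(\Delta)-\frac{1+\mu+2g}{2g}\Big]-1\Big)^{-1},$$ where $W=W_{-1}$ if $1+\mu/2g>0$ and $W=W_0$ if $1+\mu/2g<0$. **Proposition.** 1. If $\mu>0$ or $\mu<-1$, there is $g_0>0$, depending only on $\mu$, such that for $0<g<g_0$, all large enough $d$, and all $\Lambda$ large enough depending on $d$, the series of $\tau(0)$ converges (absolutely). 2. Let $g>0$, and let either $\mu>0$, or $\mu<-1$ and $1+\mu/2g<0$. Then, wherever the melonic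 series converges, the effective mass goes to $u^\star$ in the deep ultraviolet and for very large $d$: for every $\varepsilon>0$, for all large enough $d$ and all $\Lambda$ large enough depending on $d$, if the series of $\tau(0)$ converges absolutely, then $|u_{d,\Lambda}-u^\star|<\varepsilon$. 3. If $g>0$, $\mu<-1$ and $1+\mu/2g\ge 0$, then the same holds with the limit $\big(\exp[-W_0(\Delta)-\frac{1+\mu+2g}{2g}]-1\big)^{-1}$ (branch $W_0$). 4. For all $g>0$ and all real $\mu$ with $1+\mu/2g\neq0$: if $1+\mu/2g>0$, then $-1/e\le\Delta<0$ and $u^\star>0$; if $1+\mu/2g<0$, then $\Delta>0$ and $u^\star<-1$. In both cases $z=u^\star-\mu$ solves $z=2g\,\omega'(\mu+z)$, and $$u^\star=-\frac{\mu+2g}{2g\,W(\Delta)+\mu+2g},$$ the denominator being nonzero. -/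

import Mathlib

open Filter Topology MeasureTheory

noncomputable section

namespace TGFT

/-! ### The rank `d` model -/

/-- The power `2η` of the momenta in the kinetic kernel. Just-renormalizability in rank `d`
fixes `η = (d - 1) / 4`. -/
def twoEta (d : ℕ) : ℝ := ((d : ℝ) - 1) / 2

/-- `|p|^{2η} = ∑ᵢ |pᵢ|^{2η}` for an integer momentum `p ∈ ℤᵈ`. -/
def momPow (d : ℕ) (p : Fin d → ℤ) : ℝ := ∑ i, |(p i : ℝ)| ^ twoEta d

/-- The propagator `C(p) = Θ(Λ^{2η} - p^{2η}) / (p^{2η} + m^{2η})` with sharp ultraviolet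
cutoff `Λ`; the argument `M` stands for the mass parameter `m^{2η}`. -/
def propagator (d : ℕ) (Λ M : ℝ) (p : Fin d → ℤ) : ℝ :=
  if momPow d p ≤ Λ ^ twoEta d then (momPow d p + M)⁻¹ else 0

/-- The loop factor `ι(d) = ∫_{ℝ^{d-1}} δ(1 - |x|^{2η}) dx`, with
`|x|^{2η} = |x₁|^{2η} + ⋯ + |x_{d-1}|^{2η}`.  The Dirac mass is the derivative at `y = 1` of the
volume of the region `|x|^{2η} ≤ y`. -/
def iota (d : ℕ) : ℝ :=
  deriv (fun y : ℝ => (volume {x : Fin (d - 1) → ℝ | ∑ i, |x i| ^ twoEta d ≤ y}).toReal) 1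

/-! ### Melonic diagrams and their amplitudes

In the intermediate field representation, the melonic 1PI two-point diagrams are the plane rooted
trees whose edges carry colours in `{1, …, d}`: an edge of colour `c` is a quartic melonic vertex
of colour `c`, a node (loop vertex) is a cycle of propagators, and the root is an (external) edge
hooked to one of the nodes.  -/

/-- Ordered sequences of plane rooted trees with coloured edges, each tree being hung by an edge
of some colour: either the empty sequence, or a first tree - a root edge of colour `c`, below it a
loop vertex from which the sequence `children` hangs - followed by the sequence `siblings`. -/
inductive Forest (d : ℕ) : Type
  | nil : Forest d
  | cons (c : Fin d) (children siblings : Forest d) : Forest d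

/-- Number of trees in a sequence. -/
def Forest.length {d : ℕ} : Forest d → ℕ
  | .nil => 0
  | .cons _ _ s => s.length + 1

/-- Total number of loop vertices (equivalently of coloured edges) in a sequence. -/
def Forest.size {d : ℕ} : Forest d → ℕ
  | .nil => 0
  | .cons _ f s => f.size + s.size + 1

/-- The product of the amplitudes of the trees of a sequence hung on a loop vertex of momentum
`p ∈ ℤᵈ`.  The edge of colour `c` above a loop vertex identifies the components of colour `c` of
the momenta at its two ends; a loop vertex with `k` children has `k + 1` corners, hence carries
`k + 1` propagators. -/
def Forest.amplitude {d : ℕ} (Λ M : ℝ) : Forest d → (Fin d → ℤ) → ℝ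
  | .nil, _ => 1
  | .cons c f s, p =>
      (∑' q : Fin d → ℤ,
        if q c = p c then propagator d Λ M q ^ (f.length + 1) * f.amplitude Λ M q else 0)
      * s.amplitude Λ M p

/-- The Feynman amplitude, at external momentum `p ∈ ℤ`, of the melonic two-point diagram given by
the tree with external edge of colour `c` and with the sequence `f` hung on its root loop
vertex. -/
def treeAmplitude {d : ℕ} (Λ M : ℝ) (c : Fin d) (f : Forest d) (p : ℤ) : ℝ :=
  ∑' q : Fin d → ℤ,
    if q c = p then propagator d Λ M q ^ (f.length + 1) * f.amplitude Λ M q else 0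

/-- The contribution to the melonic self energy of the diagram `(c, f)`: a factor `-lam` for each
of the `f.size + 1` quartic vertices, each counted with its two orientations. -/
def melonicTerm {d : ℕ} (Λ M lam : ℝ) (c : Fin d) (p : ℤ) (f : Forest d) : ℝ :=
  (-(2 * lam)) ^ (f.size + 1) * treeAmplitude Λ M c f p

/-- The component `τ` of colour `c` of the melonic self energy `Σ(p) = ∑_c τ(p_c)`: the sum of the
perturbative expansion over all melonic diagrams with external vertex of colour `c`. -/
def tau {d : ℕ} (Λ M lam : ℝ) (c : Fin d) (p : ℤ) : ℝ :=
  ∑' f : Forest d, melonicTerm Λ M lam c p f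

/-- The rescaled coupling `λ = g / (d ι(d))`. -/
def coupling (d : ℕ) (g : ℝ) : ℝ := g / (d * iota d)

/-- Convergence of the melonic expansion of `τ(0)` in the model of rank `d` with cutoff `Λ`,
rescaled coupling `g / (d ι(d))` and dimensionless mass `μ = m^{2η} / Λ^{2η}`. -/
def MelonicSeriesConverges (d : ℕ) (Λ g μ : ℝ) (c : Fin d) : Prop :=
  Summable (melonicTerm Λ (μ * Λ ^ twoEta d) (coupling d g) c 0)

/-- The dimensionless melonic effective mass `u = μ - d τ(0) / Λ^{2η}` of that model. -/
def effectiveMass (d : ℕ) (Λ g μ : ℝ) (c : Fin d) : ℝ :=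
  μ - d * (tau Λ (μ * Λ ^ twoEta d) (coupling d g) c 0 / Λ ^ twoEta d)

/-- "In the deep ultraviolet `Λ → ∞` and for `d → ∞`, the melonic effective mass goes to `u`":
up to any `ε > 0` the effective mass is `u`, for all large enough `d` and then all `Λ` large enough
with respect to `d`, whenever the melonic expansion converges. -/
def EffectiveMassTendsTo (g μ u : ℝ) : Prop :=
  ∀ ε : ℝ, 0 < ε → ∀ᶠ d : ℕ in atTop, ∀ᶠ Λ : ℝ in atTop, ∀ c : Fin d,
    MelonicSeriesConverges d Λ g μ c → |effectiveMass d Λ g μ c - u| < ε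

/-! ### The limit -/

/-- The one-loop function `ω'(x) = 1 - x ln ((1 + x) / x)`, for `x > 0` or `x < -1`. -/
def omegaPrime (x : ℝ) : ℝ := 1 - x * Real.log ((1 + x) / x)

/-- The principal branch `W₀` of the Lambert function, on `[-1/e, ∞)`: the solution `w ≥ -1` of
`w e^w = x`. -/
def lambertW0 (x : ℝ) : ℝ := Function.invFunOn (fun w : ℝ => w * Real.exp w) (Set.Ici (-1)) x

/-- The branch `W₋₁` of the Lambert function, on `[-1/e, 0)`: the solution `w ≤ -1` of
`w e^w = x`. -/
def lambertWm1 (x : ℝ) : ℝ := Function.invFunOn (fun w : ℝ => w * Real.exp w) (Set.Iic (-1)) x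

/-- `Δ = -(μ/2g + 1) e^{-(1 + μ + 2g)/2g}`. -/
def lambertArg (g μ : ℝ) : ℝ :=
  -(μ / (2 * g) + 1) * Real.exp (-((1 + μ + 2 * g) / (2 * g)))

/-- `(exp (-w - (1 + μ + 2g)/2g) - 1)⁻¹`, where `w` is a value of the Lambert function at `Δ`. -/
def massOfLambert (g μ w : ℝ) : ℝ :=
  (Real.exp (-w - (1 + μ + 2 * g) / (2 * g)) - 1)⁻¹

/-- The value `W(Δ)`: branch `W₋₁` if `1 + μ/2g > 0` and branch `W₀` if `1 + μ/2g < 0`. -/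
def lambertValue (g μ : ℝ) : ℝ :=
  if 0 < 1 + μ / (2 * g) then lambertWm1 (lambertArg g μ) else lambertW0 (lambertArg g μ)

/-- The asymptotic effective mass `u⋆`. -/
def uStar (g μ : ℝ) : ℝ := massOfLambert g μ (lambertValue g μ)

/-- The closed form of the loop factor. -/
theorem iota_eq {d : ℕ} (hd : 3 ≤ d) :
    iota d = 2 ^ (d - 1) * Real.Gamma (((d : ℝ) + 1) / ((d : ℝ) - 1)) ^ (d - 1) := by
  have hd3 : (3 : ℝ) ≤ d := by exact_mod_cast hd
  have hp : 1 ≤ twoEta d := by unfold twoEta; linarith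
  have hp0 : 0 < twoEta d := by linarith
  have hcard : ((d - 1 : ℕ) : ℝ) = d - 1 := by
    rw [Nat.cast_sub (by omega)]; simp
  have : Nonempty (Fin (d - 1)) := ⟨⟨0, by omega⟩⟩
  have hnp : ((d - 1 : ℕ) : ℝ) / twoEta d = 2 := by
    rw [hcard]; unfold twoEta; field_simp [show (d : ℝ) - 1 ≠ 0 by linarith]
  have hG : 1 / twoEta d + 1 = ((d : ℝ) + 1) / ((d : ℝ) - 1) := by
    have : (d : ℝ) - 1 ≠ 0 := by linarith
    unfold twoEta; field_simp; ring
  set K : ℝ := 2 ^ (d - 1) * Real.Gamma (((d : ℝ) + 1) / ((d : ℝ) - 1)) ^ (d - 1) with hK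
  have hGpos : 0 < Real.Gamma (((d : ℝ) + 1) / ((d : ℝ) - 1)) :=
    Real.Gamma_pos_of_pos (div_pos (by linarith) (by linarith))
  have hK0 : 0 ≤ K := by positivity
  have hvol : ∀ y : ℝ, 0 < y →
      (volume {x : Fin (d - 1) → ℝ | ∑ i, |x i| ^ twoEta d ≤ y}).toReal = y ^ 2 * (K / 2) := by
    intro y hy
    have hset : {x : Fin (d - 1) → ℝ | ∑ i, |x i| ^ twoEta d ≤ y} =
        {x : Fin (d - 1) → ℝ | (∑ i, |x i| ^ twoEta d) ^ (1 / twoEta d) ≤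
          y ^ (1 / twoEta d)} := by
      ext x
      have hx : 0 ≤ ∑ i, |x i| ^ twoEta d :=
        Finset.sum_nonneg fun i _ => Real.rpow_nonneg (abs_nonneg _) _
      exact (Real.rpow_le_rpow_iff hx hy.le (by positivity)).symm
    rw [hset, MeasureTheory.volume_sum_rpow_le (Fin (d - 1)) hp, Fintype.card_fin, hnp, hG,
      ENNReal.toReal_mul, ENNReal.toReal_pow, ENNReal.toReal_ofReal (by positivity)]
    have h3 : Real.Gamma (2 + 1) = 2 := by
      have := Real.Gamma_nat_eq_factorial 2
      norm_num at this ⊢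
    rw [h3, mul_pow, ← hK, ENNReal.toReal_ofReal (by positivity)]
    congr 1
    rw [← Real.rpow_natCast, ← Real.rpow_mul hy.le,
      show 1 / twoEta d * ((d - 1 : ℕ) : ℝ) = (2 : ℕ) by rw [one_div_mul_eq_div, hnp]; norm_num,
      Real.rpow_natCast]
  have hev : (fun y : ℝ => (volume {x : Fin (d - 1) → ℝ | ∑ i, |x i| ^ twoEta d ≤ y}).toReal)
      =ᶠ[𝓝 1] fun y => y ^ 2 * (K / 2) := by
    filter_upwards [lt_mem_nhds (zero_lt_one' ℝ)] with y hy using hvol y hy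
  have hder : HasDerivAt (fun y : ℝ => y ^ 2 * (K / 2)) (((2 : ℕ) : ℝ) * 1 ^ (2 - 1) * (K / 2)) 1 :=
    (hasDerivAt_pow 2 (1 : ℝ)).mul_const (K / 2)
  unfold iota
  rw [hev.deriv_eq, hder.deriv]
  norm_num
  ring

end TGFT

end

namespace TGFT

/-! ### The momentum ball -/

theorem one_le_twoEta {d : ℕ} (hd : 3 ≤ d) : 1 ≤ twoEta d := by
  have : (3 : ℝ) ≤ d := by exact_mod_cast hd
  unfold twoEta; linarith

theorem momPow_nonneg (d : ℕ) (q : Fin d → ℤ) : 0 ≤ momPow d q :=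
  Finset.sum_nonneg fun _ _ => Real.rpow_nonneg (abs_nonneg _) _

theorem abs_rpow_le_momPow {d : ℕ} (q : Fin d → ℤ) (i : Fin d) :
    |(q i : ℝ)| ^ twoEta d ≤ momPow d q :=
  Finset.single_le_sum (f := fun i => |(q i : ℝ)| ^ twoEta d)
    (fun _ _ => Real.rpow_nonneg (abs_nonneg _) _) (Finset.mem_univ i)

theorem abs_le_abs_rpow {d : ℕ} (hd : 3 ≤ d) (k : ℤ) : |(k : ℝ)| ≤ |(k : ℝ)| ^ twoEta d := by
  have h1 := one_le_twoEta hd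
  rcases eq_or_ne k 0 with rfl | hk
  · simp [Real.rpow_nonneg]
  · have : (1 : ℝ) ≤ |(k : ℝ)| := by
      have := Int.one_le_abs hk
      exact_mod_cast this
    exact Real.self_le_rpow_of_one_le this h1

/-- The integer momenta with `|q|^{2η} ≤ X`. -/
noncomputable def ball (d : ℕ) (X : ℝ) : Finset (Fin d → ℤ) :=
  (Fintype.piFinset fun _ => Finset.Icc (-⌊X⌋) ⌊X⌋).filter fun q => momPow d q ≤ X

theorem mem_ball {d : ℕ} (hd : 3 ≤ d) {X : ℝ} {q : Fin d → ℤ} : q ∈ ball d X ↔ momPow d q ≤ X := by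
  unfold ball
  rw [Finset.mem_filter, and_iff_right_iff_imp]
  intro h
  rw [Fintype.mem_piFinset]
  intro i
  have : |(q i : ℝ)| ≤ X := (abs_le_abs_rpow hd _).trans ((abs_rpow_le_momPow q i).trans h)
  have h2 : |q i| ≤ ⌊X⌋ := Int.le_floor.2 (by exact_mod_cast this)
  rw [Finset.mem_Icc]
  exact abs_le.1 h2

/-- The momenta of the ball with component `c` equal to `p`. -/
noncomputable def slice (d : ℕ) (X : ℝ) (c : Fin d) (p : ℤ) : Finset (Fin d → ℤ) :=
  (ball d X).filter fun q => q c = p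

theorem mem_slice {d : ℕ} (hd : 3 ≤ d) {X : ℝ} {c : Fin d} {p : ℤ} {q : Fin d → ℤ} :
    q ∈ slice d X c p ↔ momPow d q ≤ X ∧ q c = p := by
  rw [slice, Finset.mem_filter, mem_ball hd]

theorem momPow_update {d : ℕ} (hd : 3 ≤ d) (q : Fin d → ℤ) (c : Fin d) (hq : q c = 0) (p : ℤ) :
    momPow d (Function.update q c p) = momPow d q + |(p : ℝ)| ^ twoEta d := by
  have hs : twoEta d ≠ 0 := by linarith [one_le_twoEta hd]
  unfold momPow
  rw [← Finset.add_sum_erase _ _ (Finset.mem_univ c),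
    ← Finset.add_sum_erase (a := c) _ (fun i => |(q i : ℝ)| ^ twoEta d) (Finset.mem_univ c)]
  rw [Function.update_self, hq, Int.cast_zero, abs_zero, Real.zero_rpow hs, zero_add, add_comm]
  congr 1
  refine Finset.sum_congr rfl fun i hi => ?_
  rw [Function.update_of_ne (Finset.ne_of_mem_erase hi)]

/-! ### Multiplicative weights on forests -/

/-- The multiplicative weight on sequences of trees attached to a weight `φ` on trees. -/
def Forest.weight {d : ℕ} (φ : Fin d → Forest d → ℝ) : Forest d → ℝ
  | .nil => 1
  | .cons c f s => φ c f * s.weight φ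

/-- A sequence of trees is empty or has a first tree. -/
def Forest.equivSum (d : ℕ) : Forest d ≃ Unit ⊕ ((Fin d × Forest d) × Forest d) where
  toFun
    | .nil => .inl ()
    | .cons c f s => .inr ((c, f), s)
  invFun
    | .inl _ => .nil
    | .inr ((c, f), s) => .cons c f s
  left_inv f := by cases f <;> rfl
  right_inv o := by rcases o with ⟨⟩ | ⟨⟨c, f⟩, s⟩ <;> rfl

theorem Forest.cons_nil_injective {d : ℕ} (c : Fin d) :
    Function.Injective fun f : Forest d => Forest.cons c f .nil := by
  intro f g h
  simpa using h

theorem Forest.summable_of_summable_weight {d : ℕ} {φ : Fin d → Forest d → ℝ}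
    (h : Summable (Forest.weight φ)) (c : Fin d) : Summable (φ c) := by
  have := h.comp_injective (Forest.cons_nil_injective c)
  refine this.congr fun f => ?_
  simp [Forest.weight]

theorem Forest.tsum_weight_mul {d : ℕ} {φ : Fin d → Forest d → ℝ}
    (h : Summable (Forest.weight φ)) :
    (∑' f, Forest.weight φ f) * (1 - ∑ c, ∑' f, φ c f) = 1 := by
  have h1 : Summable (Forest.weight φ ∘ (Forest.equivSum d).symm) :=
    (Forest.equivSum d).symm.summable_iff.2 h
  have h2 : Summable fun z : (Fin d × Forest d) × Forest d =>
      φ z.1.1 z.1.2 * Forest.weight φ z.2 :=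
    (h1.comp_injective (Sum.inr_injective)).congr fun z => rfl
  have h3 : Summable fun z : Fin d × Forest d => φ z.1 z.2 := by
    have := h2.comp_injective (i := fun z : Fin d × Forest d => (z, Forest.nil))
      (Prod.mk_left_injective _)
    refine this.congr fun z => ?_
    simp [Forest.weight]
  have h4 : ∑' f, Forest.weight φ f = 1 + ∑' z : (Fin d × Forest d) × Forest d,
      φ z.1.1 z.1.2 * Forest.weight φ z.2 := by
    rw [← (Forest.equivSum d).symm.tsum_eq]
    have h5 := Summable.tsum_sum (f := Forest.weight φ ∘ (Forest.equivSum d).symm)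
      (Summable.of_finite) (h1.comp_injective Sum.inr_injective)
    simpa [Forest.equivSum, Forest.weight] using h5
  have h5 : ∑' z : Fin d × Forest d, φ z.1 z.2 = ∑ c, ∑' f, φ c f := by
    rw [h3.tsum_prod, tsum_fintype]
  rw [← h3.tsum_mul_tsum h h2, h5] at h4
  linarith

theorem Forest.abs_weight {d : ℕ} (φ : Fin d → Forest d → ℝ) (f : Forest d) :
    |f.weight φ| = f.weight fun c g => |φ c g| := by
  induction f with
  | nil => simp [Forest.weight]
  | cons c f s _ ih => simp [Forest.weight, abs_mul, ih]

theorem Forest.sum_abs_lt_one {d : ℕ} {φ : Fin d → Forest d → ℝ}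
    (h : Summable (Forest.weight φ)) : |∑ c, ∑' f, φ c f| < 1 := by
  have ha : Summable (Forest.weight fun c g => |φ c g|) := by
    refine h.abs.congr fun f => ?_
    exact Forest.abs_weight φ f
  have h1 := Forest.tsum_weight_mul ha
  have h0 : 0 ≤ ∑' f, Forest.weight (fun c g => |φ c g|) f :=
    tsum_nonneg fun f => by rw [← Forest.abs_weight]; exact abs_nonneg _
  have h2 : ∑ c, ∑' f, |φ c f| < 1 := by
    by_contra hc
    push Not at hc
    nlinarith
  refine lt_of_le_of_lt ((Finset.abs_sum_le_sum_abs _ _).trans ?_) h2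
  refine Finset.sum_le_sum fun c _ => ?_
  have h3 := (Forest.summable_of_summable_weight h c).norm
  exact norm_tsum_le_tsum_norm h3

/-! ### The Schwinger-Dyson equation -/

/-- The weight `(-2λ)^n C(q)^k A(q)` of a sequence of `k` trees hung on a loop vertex. -/
noncomputable def Forest.value {d : ℕ} (Λ M lam : ℝ) (q : Fin d → ℤ) (f : Forest d) : ℝ :=
  (-(2 * lam)) ^ f.size * (propagator d Λ M q ^ f.length * f.amplitude Λ M q)

theorem tsum_eq_sum_slice {d : ℕ} (hd : 3 ≤ d) (Λ M : ℝ) (c : Fin d) (p : ℤ)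
    (F : (Fin d → ℤ) → ℝ) (hF : ∀ q, propagator d Λ M q = 0 → F q = 0) :
    (∑' q : Fin d → ℤ, if q c = p then F q else 0) = ∑ q ∈ slice d (Λ ^ twoEta d) c p, F q := by
  rw [tsum_eq_sum (s := ball d (Λ ^ twoEta d)), slice, Finset.sum_filter]
  intro q hq
  rw [mem_ball hd] at hq
  rw [hF q (by simp [propagator, hq]), ite_self]

theorem treeAmplitude_eq_sum {d : ℕ} (hd : 3 ≤ d) (Λ M : ℝ) (c : Fin d) (p : ℤ) (f : Forest d) :
    treeAmplitude Λ M c f p = ∑ q ∈ slice d (Λ ^ twoEta d) c p,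
      propagator d Λ M q * (propagator d Λ M q ^ f.length * f.amplitude Λ M q) := by
  unfold treeAmplitude
  rw [tsum_eq_sum_slice hd Λ M c p _ fun q hq => by simp [hq]]
  refine Finset.sum_congr rfl fun q _ => ?_
  ring

theorem melonicTerm_eq_sum {d : ℕ} (hd : 3 ≤ d) (Λ M lam : ℝ) (c : Fin d) (p : ℤ) (f : Forest d) :
    melonicTerm Λ M lam c p f = -(2 * lam) * ∑ q ∈ slice d (Λ ^ twoEta d) c p,
      propagator d Λ M q * f.value Λ M lam q := by
  unfold melonicTerm
  rw [treeAmplitude_eq_sum hd, Finset.mul_sum, Finset.mul_sum]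
  refine Finset.sum_congr rfl fun q _ => ?_
  unfold Forest.value
  ring

theorem Forest.amplitude_cons {d : ℕ} (Λ M : ℝ) (c : Fin d) (f s : Forest d) (q : Fin d → ℤ) :
    (Forest.cons c f s).amplitude Λ M q = treeAmplitude Λ M c f (q c) * s.amplitude Λ M q := rfl

theorem Forest.value_eq_weight {d : ℕ} (Λ M lam : ℝ) (q : Fin d → ℤ) (f : Forest d) :
    f.value Λ M lam q =
      f.weight fun c g => propagator d Λ M q * melonicTerm Λ M lam c (q c) g := by
  induction f with
  | nil => simp [Forest.value, Forest.weight, Forest.size, Forest.length, Forest.amplitude]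
  | cons c f s _ ih =>
    rw [Forest.weight, ← ih, Forest.value, Forest.value, Forest.amplitude_cons, melonicTerm,
      Forest.size, Forest.length]
    ring

/-- All the propagators have the sign of `σ`. -/
structure SameSign (d : ℕ) (Λ M σ : ℝ) : Prop where
  abs_eq_one : |σ| = 1
  eq_mul_abs : ∀ q : Fin d → ℤ, propagator d Λ M q = σ * |propagator d Λ M q|

theorem Forest.amplitude_nonneg {d : ℕ} (hd : 3 ≤ d) {Λ M σ : ℝ} (hσ : SameSign d Λ M σ)
    (f : Forest d) : ∀ q : Fin d → ℤ, 0 ≤ propagator d Λ M q ^ f.length * f.amplitude Λ M q := by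
  induction f with
  | nil => intro q; simp [Forest.length, Forest.amplitude]
  | cons c f s ihf ihs =>
    intro q
    have hσ2 : σ * σ = 1 := by
      rw [← abs_mul_abs_self, hσ.abs_eq_one, one_mul]
    have : propagator d Λ M q ^ (Forest.cons c f s).length *
        (Forest.cons c f s).amplitude Λ M q =
        |propagator d Λ M q| * (∑ k ∈ slice d (Λ ^ twoEta d) c (q c),
          |propagator d Λ M k| * (propagator d Λ M k ^ f.length * f.amplitude Λ M k)) *
        (propagator d Λ M q ^ s.length * s.amplitude Λ M q) := by
      rw [Forest.amplitude_cons, treeAmplitude_eq_sum hd, Forest.length, pow_succ]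
      have h1 : ∑ k ∈ slice d (Λ ^ twoEta d) c (q c),
          propagator d Λ M k * (propagator d Λ M k ^ f.length * f.amplitude Λ M k) =
          σ * ∑ k ∈ slice d (Λ ^ twoEta d) c (q c),
          |propagator d Λ M k| * (propagator d Λ M k ^ f.length * f.amplitude Λ M k) := by
        rw [Finset.mul_sum]
        refine Finset.sum_congr rfl fun k _ => ?_
        nth_rw 1 [hσ.eq_mul_abs k]
        ring
      rw [h1]
      nth_rw 2 [hσ.eq_mul_abs q]
      linear_combination (propagator d Λ M q ^ s.length * |propagator d Λ M q| *
        (∑ k ∈ slice d (Λ ^ twoEta d) c (q c),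
          |propagator d Λ M k| * (propagator d Λ M k ^ f.length * f.amplitude Λ M k)) *
        s.amplitude Λ M q) * hσ2
    rw [this]
    refine mul_nonneg (mul_nonneg (abs_nonneg _) (Finset.sum_nonneg fun k _ => ?_)) (ihs q)
    exact mul_nonneg (abs_nonneg _) (ihf k)

theorem abs_melonicTerm {d : ℕ} (hd : 3 ≤ d) {Λ M σ : ℝ} (hσ : SameSign d Λ M σ) (lam : ℝ)
    (c : Fin d) (p : ℤ) (f : Forest d) :
    |melonicTerm Λ M lam c p f| = |2 * lam| * ∑ q ∈ slice d (Λ ^ twoEta d) c p,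
      |propagator d Λ M q| * |f.value Λ M lam q| := by
  have h1 : treeAmplitude Λ M c f p = σ * ∑ q ∈ slice d (Λ ^ twoEta d) c p,
      |propagator d Λ M q| * (propagator d Λ M q ^ f.length * f.amplitude Λ M q) := by
    rw [treeAmplitude_eq_sum hd, Finset.mul_sum]
    refine Finset.sum_congr rfl fun k _ => ?_
    nth_rw 1 [hσ.eq_mul_abs k]
    ring
  unfold melonicTerm
  rw [h1, abs_mul, abs_mul, hσ.abs_eq_one, one_mul, abs_pow, abs_neg, Finset.abs_sum_of_nonneg,
    Finset.mul_sum, Finset.mul_sum]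
  · refine Finset.sum_congr rfl fun k _ => ?_
    rw [Forest.value, abs_mul ((-(2 * lam)) ^ f.size),
      abs_of_nonneg (Forest.amplitude_nonneg hd hσ f k), abs_pow, abs_neg]
    ring
  · intro k _
    exact mul_nonneg (abs_nonneg _) (Forest.amplitude_nonneg hd hσ f k)

theorem summable_value_of_summable_melonicTerm {d : ℕ} (hd : 3 ≤ d) {Λ M σ lam : ℝ}
    (hσ : SameSign d Λ M σ) (hlam : lam ≠ 0) {c : Fin d} {p : ℤ}
    (h : Summable (melonicTerm Λ M lam c p)) {q : Fin d → ℤ} (hq : momPow d q ≤ Λ ^ twoEta d)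
    (hqc : q c = p) (hC : propagator d Λ M q ≠ 0) : Summable (Forest.value Λ M lam q) := by
  have h1 : Summable fun f => (|2 * lam| * |propagator d Λ M q|)⁻¹ * |melonicTerm Λ M lam c p f| :=
    h.abs.mul_left _
  refine Summable.of_norm_bounded h1 fun f => ?_
  have hpos : 0 < |2 * lam| * |propagator d Λ M q| := by positivity
  rw [Real.norm_eq_abs, le_inv_mul_iff₀ hpos, abs_melonicTerm hd hσ, mul_assoc]
  refine mul_le_mul_of_nonneg_left ?_ (abs_nonneg _)
  exact Finset.single_le_sum (f := fun q => |propagator d Λ M q| * |f.value Λ M lam q|)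
    (fun _ _ => by positivity) ((mem_slice hd).2 ⟨hq, hqc⟩)

theorem summable_melonicTerm_of_summable_value {d : ℕ} {Λ M lam : ℝ} {q : Fin d → ℤ}
    (h : Summable (Forest.value Λ M lam q)) (hC : propagator d Λ M q ≠ 0) (c : Fin d) :
    Summable (melonicTerm Λ M lam c (q c)) := by
  have h1 : Summable (Forest.weight fun c g => propagator d Λ M q *
      melonicTerm Λ M lam c (q c) g) := h.congr fun f => Forest.value_eq_weight Λ M lam q f
  exact (summable_mul_left_iff hC).1 (Forest.summable_of_summable_weight h1 c)

theorem momPow_update_zero {d : ℕ} (hd : 3 ≤ d) (c : Fin d) (p : ℤ) :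
    momPow d (Function.update 0 c p) = |(p : ℝ)| ^ twoEta d := by
  have hs : twoEta d ≠ 0 := by linarith [one_le_twoEta hd]
  rw [momPow_update hd 0 c rfl]
  simp [momPow, Real.zero_rpow hs]

/-- If the melonic series converges at one colour and at zero momentum, it converges at all colours
and all momenta below the cutoff. -/
theorem summable_melonicTerm {d : ℕ} (hd : 3 ≤ d) {Λ M σ lam : ℝ} (hΛ : 0 ≤ Λ)
    (hσ : SameSign d Λ M σ) (hlam : lam ≠ 0)
    (hC : ∀ q : Fin d → ℤ, momPow d q ≤ Λ ^ twoEta d → propagator d Λ M q ≠ 0) {c : Fin d}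
    (h : Summable (melonicTerm Λ M lam c 0)) (c' : Fin d) (p : ℤ)
    (hp : |(p : ℝ)| ^ twoEta d ≤ Λ ^ twoEta d) : Summable (melonicTerm Λ M lam c' p) := by
  have step : ∀ {a b : Fin d} {p : ℤ}, a ≠ b → |(p : ℝ)| ^ twoEta d ≤ Λ ^ twoEta d →
      Summable (melonicTerm Λ M lam a 0) → Summable (melonicTerm Λ M lam b p) := by
    intro a b p hab hp ha
    have hm : momPow d (Function.update 0 b p) ≤ Λ ^ twoEta d := by rwa [momPow_update_zero hd]
    have h1 := summable_value_of_summable_melonicTerm hd hσ hlam ha hm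
      (by simp [Function.update_of_ne hab]) (hC _ hm)
    have h2 := summable_melonicTerm_of_summable_value h1 (hC _ hm) b
    rwa [Function.update_self] at h2
  have hs : twoEta d ≠ 0 := by linarith [one_le_twoEta hd]
  have h0 : |((0 : ℤ) : ℝ)| ^ twoEta d ≤ Λ ^ twoEta d := by
    simp only [Int.cast_zero, abs_zero, Real.zero_rpow hs]
    positivity
  rcases eq_or_ne c c' with rfl | hcc
  · have : Nontrivial (Fin d) := Fin.nontrivial_iff_two_le.2 (by omega)
    obtain ⟨b, hb⟩ := exists_ne c
    exact step hb hp (step hb.symm h0 h)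
  · exact step hcc hp h

/-- The inverse of the full propagator. -/
noncomputable def denominator {d : ℕ} (Λ M lam : ℝ) (q : Fin d → ℤ) : ℝ :=
  momPow d q + M - ∑ c, tau Λ M lam c (q c)

theorem propagator_of_mem {d : ℕ} {Λ M : ℝ} {q : Fin d → ℤ} (hq : momPow d q ≤ Λ ^ twoEta d) :
    propagator d Λ M q = (momPow d q + M)⁻¹ := if_pos hq

theorem denominator_eq {d : ℕ} {Λ M lam : ℝ} {q : Fin d → ℤ} (hq : momPow d q ≤ Λ ^ twoEta d)
    (hC : propagator d Λ M q ≠ 0) : denominator Λ M lam q = (propagator d Λ M q)⁻¹ *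
      (1 - ∑ c, ∑' f, propagator d Λ M q * melonicTerm Λ M lam c (q c) f) := by
  simp_rw [tsum_mul_left, ← Finset.mul_sum]
  rw [mul_sub, ← mul_assoc, inv_mul_cancel₀ hC, propagator_of_mem hq, inv_inv]
  simp [denominator, tau]

/-- The Schwinger-Dyson equation of the melonic self energy. -/
theorem tau_eq_sum {d : ℕ} (hd : 3 ≤ d) {Λ M σ lam : ℝ}
    (hσ : SameSign d Λ M σ) (hlam : lam ≠ 0)
    (hC : ∀ q : Fin d → ℤ, momPow d q ≤ Λ ^ twoEta d → propagator d Λ M q ≠ 0) {c : Fin d} {p : ℤ}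
    (h : Summable (melonicTerm Λ M lam c p)) :
    tau Λ M lam c p =
        -(2 * lam) * ∑ q ∈ slice d (Λ ^ twoEta d) c p, (denominator Λ M lam q)⁻¹ := by
  have hv : ∀ q ∈ slice d (Λ ^ twoEta d) c p, Summable (Forest.value Λ M lam q) := fun q hq =>
    have hq := (mem_slice hd).1 hq
    summable_value_of_summable_melonicTerm hd hσ hlam h hq.1 hq.2 (hC q hq.1)
  unfold tau
  simp_rw [melonicTerm_eq_sum hd, tsum_mul_left]
  rw [Summable.tsum_finsetSum fun q hq => (hv q hq).mul_left _]
  congr 1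
  refine Finset.sum_congr rfl fun q hq => ?_
  have hq' := (mem_slice hd).1 hq
  rw [tsum_mul_left, denominator_eq hq'.1 (hC q hq'.1), mul_inv, inv_inv]
  congr 1
  have h1 : Summable (Forest.weight fun c g => propagator d Λ M q *
      melonicTerm Λ M lam c (q c) g) :=
    (hv q hq).congr fun f => Forest.value_eq_weight Λ M lam q f
  rw [tsum_congr fun f => Forest.value_eq_weight Λ M lam q f]
  exact eq_inv_of_mul_eq_one_left (Forest.tsum_weight_mul h1)

theorem denominator_sign {d : ℕ} (hd : 3 ≤ d) {Λ M σ lam : ℝ}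
    (hσ : SameSign d Λ M σ) (hlam : lam ≠ 0) {c : Fin d}
    {q : Fin d → ℤ} (hq : momPow d q ≤ Λ ^ twoEta d) (hC : propagator d Λ M q ≠ 0)
    (h : Summable (melonicTerm Λ M lam c (q c))) : 0 < σ * denominator Λ M lam q := by
  have hv := summable_value_of_summable_melonicTerm hd hσ hlam h hq rfl hC
  have h1 : Summable (Forest.weight fun c g => propagator d Λ M q *
      melonicTerm Λ M lam c (q c) g) :=
    hv.congr fun f => Forest.value_eq_weight Λ M lam q f
  have h2 := (abs_lt.1 (Forest.sum_abs_lt_one h1)).2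
  rw [denominator_eq hq hC, ← mul_assoc]
  refine mul_pos ?_ (by linarith)
  have hσ2 : σ * σ = 1 := by rw [← abs_mul_abs_self, hσ.abs_eq_one, one_mul]
  rw [hσ.eq_mul_abs q, mul_inv, ← mul_assoc, mul_inv_cancel₀ (by rintro rfl; simp at hσ2), one_mul]
  exact inv_pos.2 (abs_pos.2 hC)

/-! ### Colour symmetry -/

/-- Relabelling of the colours. -/
def Forest.relabel {d : ℕ} (e : Equiv.Perm (Fin d)) : Forest d → Forest d
  | .nil => .nil
  | .cons c f s => .cons (e c) (f.relabel e) (s.relabel e)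

theorem Forest.relabel_relabel {d : ℕ} {e e' : Equiv.Perm (Fin d)} (h : ∀ c, e' (e c) = c)
    (f : Forest d) : (f.relabel e).relabel e' = f := by
  induction f with
  | nil => rfl
  | cons c f s ihf ihs => simp [Forest.relabel, ihf, ihs, h]

/-- Relabelling of the colours as a bijection. -/
def Forest.relabelEquiv {d : ℕ} (e : Equiv.Perm (Fin d)) : Forest d ≃ Forest d where
  toFun := Forest.relabel e
  invFun := Forest.relabel e.symm
  left_inv := Forest.relabel_relabel fun c => e.symm_apply_apply c
  right_inv := Forest.relabel_relabel fun c => e.apply_symm_apply c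

theorem Forest.length_relabel {d : ℕ} (e : Equiv.Perm (Fin d)) (f : Forest d) :
    (f.relabel e).length = f.length := by
  induction f with
  | nil => rfl
  | cons c f s _ ihs => simp [Forest.relabel, Forest.length, ihs]

theorem Forest.size_relabel {d : ℕ} (e : Equiv.Perm (Fin d)) (f : Forest d) :
    (f.relabel e).size = f.size := by
  induction f with
  | nil => rfl
  | cons c f s ihf ihs => simp [Forest.relabel, Forest.size, ihf, ihs]

theorem propagator_comp {d : ℕ} (Λ M : ℝ) (e : Equiv.Perm (Fin d)) (q : Fin d → ℤ) :
    propagator d Λ M (q ∘ e) = propagator d Λ M q := by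
  have : momPow d (q ∘ e) = momPow d q := by
    unfold momPow
    exact Equiv.sum_comp e fun i => |(q i : ℝ)| ^ twoEta d
  simp [propagator, this]

theorem treeAmplitude_relabel_of {d : ℕ} (Λ M : ℝ) (e : Equiv.Perm (Fin d)) (c : Fin d)
    (f : Forest d) (p : ℤ)
    (h : ∀ q, (f.relabel e).amplitude Λ M q = f.amplitude Λ M (q ∘ e)) :
    treeAmplitude Λ M (e c) (f.relabel e) p = treeAmplitude Λ M c f p := by
  unfold treeAmplitude
  rw [← (Equiv.arrowCongr e (Equiv.refl ℤ)).tsum_eq]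
  refine tsum_congr fun q => ?_
  have h1 : (Equiv.arrowCongr e (Equiv.refl ℤ)) q = q ∘ e.symm := by ext; simp
  have h2 : (q ∘ e.symm) ∘ e = q := by ext; simp
  rw [h1, propagator_comp, h, Forest.length_relabel, h2, Function.comp_apply,
    Equiv.symm_apply_apply]

theorem Forest.amplitude_relabel {d : ℕ} (Λ M : ℝ) (e : Equiv.Perm (Fin d)) (f : Forest d) :
    ∀ q, (f.relabel e).amplitude Λ M q = f.amplitude Λ M (q ∘ e) := by
  induction f with
  | nil => intro q; rfl
  | cons c f s ihf ihs =>
    intro q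
    rw [Forest.relabel, Forest.amplitude_cons, Forest.amplitude_cons, ihs,
      treeAmplitude_relabel_of Λ M e c f _ ihf]
    rfl

theorem tau_colour {d : ℕ} (Λ M lam : ℝ) (c c' : Fin d) (p : ℤ) :
    tau Λ M lam c p = tau Λ M lam c' p := by
  unfold tau
  rw [← (Forest.relabelEquiv (Equiv.swap c' c)).tsum_eq]
  refine tsum_congr fun f => ?_
  have h := treeAmplitude_relabel_of Λ M (Equiv.swap c' c) c' f p (Forest.amplitude_relabel Λ M _ f)
  rw [Equiv.swap_apply_left] at h
  simp only [melonicTerm, Forest.relabelEquiv, Equiv.coe_fn_mk, h, Forest.size_relabel]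


/-! ### Convergence at small coupling -/

theorem card_slice_le {d : ℕ} (hd : 3 ≤ d) (X : ℝ) (c : Fin d) (p : ℤ) :
    (slice d X c p).card ≤ (slice d X c 0).card := by
  refine Finset.card_le_card_of_injOn (fun q => Function.update q c 0) ?_ ?_
  · intro q hq
    have hq := (mem_slice hd).1 hq
    refine (mem_slice hd).2 ⟨?_, Function.update_self ..⟩
    have h := momPow_update hd (Function.update q c 0) c (Function.update_self ..) (q c)
    rw [Function.update_idem, Function.update_eq_self] at h
    have : 0 ≤ |(q c : ℝ)| ^ twoEta d := Real.rpow_nonneg (abs_nonneg _) _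
    linarith [hq.1]
  · intro q hq q' hq' h
    have hq := ((mem_slice hd).1 hq).2
    have hq' := ((mem_slice hd).1 hq').2
    have h2 := congrArg (fun f => Function.update f c p) h
    simp only [Function.update_idem] at h2
    nth_rw 1 [← hq] at h2
    rwa [← hq', Function.update_eq_self, Function.update_eq_self] at h2

/-- The sequences of trees of height less than `n`. -/
def Forest.ofHeight (d : ℕ) : ℕ → Finset (Forest d)
  | 0 => ∅
  | n + 1 => ((Finset.univ : Finset Unit).disjSum
      ((Finset.univ ×ˢ Forest.ofHeight d n) ×ˢ Forest.ofHeight d n)).map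
        (Forest.equivSum d).symm.toEmbedding

theorem Forest.mem_ofHeight {d : ℕ} (f : Forest d) :
    ∀ n, f.size < n → f ∈ Forest.ofHeight d n := by
  induction f with
  | nil =>
    rintro (_ | n) hn
    · omega
    · exact Finset.mem_map.2 ⟨.inl (), by simp, rfl⟩
  | cons c f s ihf ihs =>
    rintro (_ | n) hn
    · omega
    · rw [Forest.size] at hn
      exact Finset.mem_map.2 ⟨.inr ((c, f), s),
        by simp [ihf n (by omega), ihs n (by omega)], rfl⟩

theorem Forest.sum_ofHeight_le {d : ℕ} {y : ℝ} (hy : 0 ≤ y) (h : 4 * d * y ≤ 1) (n : ℕ) :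
    ∑ f ∈ Forest.ofHeight d n, y ^ f.size ≤ 2 := by
  induction n with
  | zero => simp [Forest.ofHeight]
  | succ n ih =>
    set S := ∑ f ∈ Forest.ofHeight d n, y ^ f.size with hS
    have h0 : 0 ≤ S := Finset.sum_nonneg fun f _ => pow_nonneg hy _
    have h1 : ∑ f ∈ Forest.ofHeight d (n + 1), y ^ f.size = 1 + d * y * S * S := by
      rw [Forest.ofHeight, Finset.sum_map, Finset.sum_disjSum, Finset.sum_product,
        Finset.sum_product]
      have : ∀ (c : Fin d) (f s : Forest d),
          y ^ (((Forest.equivSum d).symm.toEmbedding (.inr ((c, f), s)) : Forest d)).size =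
            y * y ^ f.size * y ^ s.size := by
        intro c f s
        change y ^ (f.size + s.size + 1) = _
        ring
      simp only [this, ← Finset.mul_sum, ← Finset.sum_mul, ← hS]
      simp [Forest.equivSum, Forest.size]
      ring
    rw [h1]
    have : d * y * S * S ≤ 1 := by
      have h2 : S * S ≤ 4 := by nlinarith
      have h3 : 0 ≤ d * y := by positivity
      nlinarith
    linarith

theorem Forest.summable_pow_size {d : ℕ} {y : ℝ} (hy : 0 ≤ y) (h : 4 * d * y ≤ 1) :
    Summable fun f : Forest d => y ^ f.size := by
  refine summable_of_sum_le (c := 2) (fun f => pow_nonneg hy _) fun u => ?_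
  refine (Finset.sum_le_sum_of_subset_of_nonneg ?_ fun f _ _ => pow_nonneg hy _).trans
    (Forest.sum_ofHeight_le hy h (u.sup Forest.size + 1))
  intro f hf
  exact Forest.mem_ofHeight f _ (Nat.lt_succ_of_le (Finset.le_sup hf))

theorem abs_melonicTerm_le_of {d : ℕ} (hd : 3 ≤ d) {Λ M lam b N y : ℝ} (hb : 0 ≤ b)
    (hC : ∀ q, |propagator d Λ M q| ≤ b)
    {c : Fin d} {p : ℤ} (hs : ((slice d (Λ ^ twoEta d) c p).card : ℝ) ≤ N) {f : Forest d}
    (hy : 0 ≤ y)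
    (hf : ∀ q, |f.value Λ M lam q| ≤ y ^ f.size) :
    |melonicTerm Λ M lam c p f| ≤ |2 * lam| * N * b * y ^ f.size := by
  rw [melonicTerm_eq_sum hd, abs_mul, abs_neg, mul_assoc, mul_assoc]
  refine mul_le_mul_of_nonneg_left ?_ (abs_nonneg _)
  calc |∑ q ∈ slice d (Λ ^ twoEta d) c p, propagator d Λ M q * f.value Λ M lam q|
      ≤ ∑ q ∈ slice d (Λ ^ twoEta d) c p, b * y ^ f.size := by
        refine (Finset.abs_sum_le_sum_abs _ _).trans (Finset.sum_le_sum fun q _ => ?_)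
        rw [abs_mul]
        exact mul_le_mul (hC q) (hf q) (abs_nonneg _) hb
    _ ≤ N * (b * y ^ f.size) := by
        rw [Finset.sum_const, nsmul_eq_mul]
        gcongr

theorem abs_value_le {d : ℕ} (hd : 3 ≤ d) {Λ M lam b N : ℝ} (hN : 0 ≤ N) (hb : 0 ≤ b)
    (hC : ∀ q, |propagator d Λ M q| ≤ b)
    (hs : ∀ c, ((slice d (Λ ^ twoEta d) c 0).card : ℝ) ≤ N) (f : Forest d) :
    ∀ q, |f.value Λ M lam q| ≤ (|2 * lam| * N * b ^ 2) ^ f.size := by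
  have hs' : ∀ c p, ((slice d (Λ ^ twoEta d) c p).card : ℝ) ≤ N := fun c p =>
    le_trans (by exact_mod_cast card_slice_le hd _ c p) (hs c)
  have hy : 0 ≤ |2 * lam| * N * b ^ 2 := by positivity
  induction f with
  | nil => intro q; simp [Forest.value, Forest.size, Forest.length, Forest.amplitude]
  | cons c f s ihf ihs =>
    intro q
    rw [Forest.value_eq_weight, Forest.weight, ← Forest.value_eq_weight, abs_mul, abs_mul,
      Forest.size]
    have h1 := abs_melonicTerm_le_of hd hb hC (hs' c (q c)) hy ihf
    calc |propagator d Λ M q| * |melonicTerm Λ M lam c (q c) f| * |s.value Λ M lam q|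
        ≤ b * (|2 * lam| * N * b * (|2 * lam| * N * b ^ 2) ^ f.size) *
            (|2 * lam| * N * b ^ 2) ^ s.size := by
          gcongr
          · exact hC q
          · exact ihs q
      _ = (|2 * lam| * N * b ^ 2) ^ (f.size + s.size + 1) := by ring

theorem summable_melonicTerm_of_small {d : ℕ} (hd : 3 ≤ d) {Λ M lam b N : ℝ} (hN : 0 ≤ N)
    (hb : 0 ≤ b) (hC : ∀ q, |propagator d Λ M q| ≤ b)
    (hs : ∀ c, ((slice d (Λ ^ twoEta d) c 0).card : ℝ) ≤ N)
    (h : 4 * d * (|2 * lam| * N * b ^ 2) ≤ 1) (c : Fin d) :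
    Summable (melonicTerm Λ M lam c 0) := by
  have hy : 0 ≤ |2 * lam| * N * b ^ 2 := by positivity
  refine Summable.of_norm_bounded
    ((Forest.summable_pow_size hy h).mul_left (|2 * lam| * N * b)) fun f => ?_
  exact abs_melonicTerm_le_of hd hb hC (hs c) hy (abs_value_le hd hN hb hC hs f)

/-! ### Counting lattice points -/

/-- The number of integer points with `|x|^{2η} ≤ Y` in dimension `d - 1`, with the exponent of
rank `d`. -/
noncomputable def latticeCount (d : ℕ) (Y : ℝ) : ℕ :=
  Nat.card {x : Fin (d - 1) → ℤ | ∑ i, |(x i : ℝ)| ^ twoEta d ≤ Y}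

theorem momPow_insertNth {n : ℕ} (hd : 3 ≤ n + 1) (c : Fin (n + 1)) (x : Fin n → ℤ) :
    momPow (n + 1) (c.insertNth (α := fun _ => ℤ) 0 x) =
      ∑ i, |(x i : ℝ)| ^ twoEta (n + 1) := by
  have hs : twoEta (n + 1) ≠ 0 := by linarith [one_le_twoEta hd]
  unfold momPow
  rw [Fin.sum_univ_succAbove _ c]
  simp [Real.zero_rpow hs]

theorem card_slice_zero {d : ℕ} (hd : 3 ≤ d) (Y : ℝ) (c : Fin d) :
    (slice d Y c 0).card = latticeCount d Y := by
  obtain ⟨n, rfl⟩ : ∃ n, d = n + 1 := ⟨d - 1, by omega⟩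
  rw [latticeCount, ← Nat.card_eq_finsetCard]
  have hmem : ∀ x : {x : Fin n → ℤ | ∑ i, |(x i : ℝ)| ^ twoEta (n + 1) ≤ Y},
      c.insertNth (α := fun _ => ℤ) 0 x.1 ∈ slice (n + 1) Y c 0 := fun x =>
    (mem_slice hd).2 ⟨by rw [momPow_insertNth hd]; exact x.2, by simp⟩
  refine (Nat.card_congr (Equiv.ofBijective (fun x => ⟨_, hmem x⟩) ⟨?_, ?_⟩)).symm
  · intro x y h
    simpa [Subtype.ext_iff] using h
  · rintro ⟨q, hq⟩
    have hq := (mem_slice hd).1 hq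
    have h1 : c.insertNth (α := fun _ => ℤ) 0 (c.removeNth q) = q := by
      rw [← hq.2]
      exact Fin.insertNth_self_removeNth c q
    refine ⟨⟨c.removeNth q, ?_⟩, Subtype.ext h1⟩
    change ∑ i, |((c.removeNth q i : ℤ) : ℝ)| ^ twoEta (n + 1) ≤ Y
    rw [← momPow_insertNth hd c, h1]
    exact hq.1

theorem volume_real_sum_rpow_le_one {d : ℕ} (hd : 3 ≤ d) :
    volume.real {x : Fin (d - 1) → ℝ | ∑ i, |x i| ^ twoEta d ≤ 1} = iota d / 2 := by
  have hd3 : (3 : ℝ) ≤ d := by exact_mod_cast hd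
  have hp := one_le_twoEta hd
  have hp0 : 0 < twoEta d := by linarith
  have hcard : ((d - 1 : ℕ) : ℝ) = d - 1 := by
    rw [Nat.cast_sub (by omega)]; simp
  have : Nonempty (Fin (d - 1)) := ⟨⟨0, by omega⟩⟩
  have hd1 : (d : ℝ) - 1 ≠ 0 := by linarith
  have hnp : ((d - 1 : ℕ) : ℝ) / twoEta d = 2 := by
    rw [hcard]; unfold twoEta; field_simp
  have hG : 1 / twoEta d + 1 = ((d : ℝ) + 1) / ((d : ℝ) - 1) := by
    unfold twoEta; field_simp; ring
  have hset : {x : Fin (d - 1) → ℝ | ∑ i, |x i| ^ twoEta d ≤ 1} =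
      {x : Fin (d - 1) → ℝ | (∑ i, |x i| ^ twoEta d) ^ (1 / twoEta d) ≤ 1} := by
    ext x
    have hx : 0 ≤ ∑ i, |x i| ^ twoEta d :=
      Finset.sum_nonneg fun i _ => Real.rpow_nonneg (abs_nonneg _) _
    have := Real.rpow_le_rpow_iff (z := 1 / twoEta d) hx zero_le_one (by positivity)
    rw [Real.one_rpow] at this
    exact this.symm
  have hGpos : 0 < Real.Gamma (((d : ℝ) + 1) / ((d : ℝ) - 1)) :=
    Real.Gamma_pos_of_pos (div_pos (by linarith) (by linarith))
  have h3 : Real.Gamma (2 + 1) = 2 := by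
    have := Real.Gamma_nat_eq_factorial 2
    norm_num at this ⊢
  rw [measureReal_def, hset, MeasureTheory.volume_sum_rpow_le (Fin (d - 1)) hp, Fintype.card_fin,
    hnp, hG, h3, ENNReal.ofReal_one, one_pow, one_mul, ENNReal.toReal_ofReal (by positivity),
    iota_eq hd, mul_pow]

theorem iota_pos {d : ℕ} (hd : 3 ≤ d) : 0 < iota d := by
  have hd3 : (3 : ℝ) ≤ d := by exact_mod_cast hd
  rw [iota_eq hd]
  have := Real.Gamma_pos_of_pos (s := ((d : ℝ) + 1) / ((d : ℝ) - 1))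
    (div_pos (by linarith) (by linarith))
  positivity

theorem convexOn_sum_abs_rpow {n : ℕ} {s : ℝ} (hs : 1 ≤ s) :
    ConvexOn ℝ Set.univ fun x : Fin n → ℝ => ∑ i, |x i| ^ s := by
  refine ⟨convex_univ, fun x _ y _ a b ha hb hab => ?_⟩
  simp only [smul_eq_mul, Finset.mul_sum, ← Finset.sum_add_distrib]
  refine Finset.sum_le_sum fun i _ => ?_
  calc |(a • x + b • y) i| ^ s ≤ (a * |x i| + b * |y i|) ^ s := by
        refine Real.rpow_le_rpow (abs_nonneg _) ?_ (by linarith)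
        refine (abs_add_le _ _).trans (le_of_eq ?_)
        simp [abs_mul, abs_of_nonneg ha, abs_of_nonneg hb]
    _ ≤ a * |x i| ^ s + b * |y i| ^ s :=
        (convexOn_rpow hs).2 (abs_nonneg (x i)) (abs_nonneg (y i)) ha hb hab

theorem mem_span_basisFun {n : ℕ} {x : Fin n → ℝ} :
    x ∈ (Submodule.span ℤ (Set.range (Pi.basisFun ℝ (Fin n))) : Set (Fin n → ℝ)) ↔
      ∃ z : Fin n → ℤ, x = fun i => (z i : ℝ) := by
  rw [SetLike.mem_coe, Module.Basis.mem_span_iff_repr_mem]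
  simp only [Pi.basisFun_repr, Set.mem_range, eq_intCast]
  constructor
  · intro h
    choose z hz using h
    exact ⟨z, funext fun i => (hz i).symm⟩
  · rintro ⟨z, rfl⟩ i
    exact ⟨z i, rfl⟩

open scoped Pointwise in
theorem latticeCount_eq_card {d : ℕ} {x : ℝ} (hx : 0 < x) :
    Nat.card ↑({y : Fin (d - 1) → ℝ | ∑ i, |y i| ^ twoEta d ≤ 1} ∩
      x⁻¹ • (Submodule.span ℤ (Set.range (Pi.basisFun ℝ (Fin (d - 1)))) :
        Set (Fin (d - 1) → ℝ))) = latticeCount d (x ^ twoEta d) := by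
  have hinj : Function.Injective fun (z : Fin (d - 1) → ℤ) (i : Fin (d - 1)) => x⁻¹ * (z i : ℝ) := by
    intro z z' h
    ext i
    have := congrFun h i
    simpa [hx.ne'] using this
  have key : ∀ z : Fin (d - 1) → ℤ, ∑ i, |x⁻¹ * (z i : ℝ)| ^ twoEta d ≤ 1 ↔
      ∑ i, |(z i : ℝ)| ^ twoEta d ≤ x ^ twoEta d := by
    intro z
    have hxs : 0 < x ^ twoEta d := Real.rpow_pos_of_pos hx _
    simp_rw [abs_mul, Real.mul_rpow (abs_nonneg _) (abs_nonneg _), ← Finset.mul_sum,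
      abs_of_pos (inv_pos.2 hx), Real.inv_rpow hx.le]
    rw [inv_mul_le_iff₀ hxs, mul_one]
  rw [latticeCount, ← Nat.card_image_of_injective hinj]
  congr 2
  ext y
  simp only [Set.mem_inter_iff, Set.mem_smul_set, Set.mem_image, mem_span_basisFun]
  constructor
  · rintro ⟨h1, _, ⟨z, rfl⟩, rfl⟩
    exact ⟨z, (key z).1 h1, rfl⟩
  · rintro ⟨z, hz, rfl⟩
    exact ⟨(key z).2 hz, _, ⟨z, rfl⟩, rfl⟩

open scoped Pointwise in
theorem tendsto_latticeCount {d : ℕ} (hd : 3 ≤ d) :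
    Tendsto (fun Y : ℝ => latticeCount d Y / Y ^ 2) atTop (𝓝 (iota d / 2)) := by
  have hs1 := one_le_twoEta hd
  have hs0 : 0 < twoEta d := by linarith
  set s : Set (Fin (d - 1) → ℝ) := {x | ∑ i, |x i| ^ twoEta d ≤ 1} with hs
  have hcont : Continuous fun x : Fin (d - 1) → ℝ => ∑ i, |x i| ^ twoEta d :=
    continuous_finsetSum _ fun i _ => (continuous_apply i).abs.rpow_const fun _ => Or.inr hs0.le
  have hclosed : IsClosed s := isClosed_le hcont continuous_const
  have hconv : Convex ℝ s := by simpa [hs] using (convexOn_sum_abs_rpow hs1).convex_le 1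
  have hzero : (0 : Fin (d - 1) → ℝ) ∈ s := by simp [hs, Real.zero_rpow hs0.ne']
  have hbdd : Bornology.IsBounded s := by
    refine (Metric.isBounded_iff_subset_closedBall 0).2 ⟨1, fun x hx => ?_⟩
    rw [mem_closedBall_zero_iff, pi_norm_le_iff_of_nonneg zero_le_one]
    intro i
    have h1 : |x i| ^ twoEta d ≤ 1 := le_trans (Finset.single_le_sum
      (f := fun i => |x i| ^ twoEta d) (fun _ _ => Real.rpow_nonneg (abs_nonneg _) _)
      (Finset.mem_univ i)) hx
    by_contra hc
    push Not at hc
    exact absurd h1 (not_le.2 (Real.one_lt_rpow hc hs0))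
  have hmono : ∀ ⦃x y : ℝ⦄, 0 < x → x ≤ y → x • s ⊆ y • s := by
    rintro x y hx hxy _ ⟨z, hz, rfl⟩
    have hy : 0 < y := hx.trans_le hxy
    refine ⟨(x / y) • z, ?_, ?_⟩
    · exact hconv.smul_mem_of_zero_mem hzero hz ⟨by positivity, (div_le_one hy).2 hxy⟩
    · simp only [smul_smul]
      rw [mul_div_cancel₀ _ hy.ne']
  have h1 := tendsto_card_div_pow_atTop_volume' s hbdd hclosed.measurableSet
    (hconv.addHaar_frontier volume) hmono
  rw [hs, volume_real_sum_rpow_le_one hd, Fintype.card_fin] at h1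
  have h2 := h1.comp (tendsto_rpow_atTop (inv_pos.2 hs0))
  refine h2.congr' ?_
  filter_upwards [eventually_gt_atTop 0] with Y hY
  rw [Function.comp_apply, latticeCount_eq_card (Real.rpow_pos_of_pos hY _),
    Real.rpow_inv_rpow hY.le hs0.ne']
  congr 1
  have hcard : ((d - 1 : ℕ) : ℝ) = 2 * twoEta d := by
    rw [Nat.cast_sub (by omega)]; unfold twoEta; simp; ring
  rw [← Real.rpow_natCast, ← Real.rpow_mul hY.le, hcard]
  rw [show (twoEta d)⁻¹ * (2 * twoEta d) = (2 : ℕ) by field_simp; norm_num, Real.rpow_natCast]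

theorem latticeCount_mono {d : ℕ} (hd : 3 ≤ d) : Monotone (latticeCount d) := by
  intro Y Y' h
  rw [← card_slice_zero hd Y ⟨0, by omega⟩, ← card_slice_zero hd Y' ⟨0, by omega⟩]
  refine Finset.card_le_card fun q hq => ?_
  rw [mem_slice hd] at hq ⊢
  exact ⟨hq.1.trans h, hq.2⟩

/-- Lattice point counting, uniformly on dilated balls. -/
theorem eventually_latticeCount {d : ℕ} (hd : 3 ≤ d) {e : ℝ} (he : 0 < e) :
    ∀ᶠ X : ℝ in atTop, ∀ r : ℝ, 0 ≤ r → r ≤ 1 →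
      |latticeCount d (r * X) / (iota d * X ^ 2) - r ^ 2 / 2| ≤ e := by
  have hι := iota_pos hd
  have h1 := Metric.tendsto_atTop.1 (tendsto_latticeCount hd) (e * iota d) (by positivity)
  obtain ⟨Y₀, hY₀⟩ := h1
  set Y := max Y₀ 1 with hYdef
  have hY : 0 < Y := lt_max_of_lt_right one_pos
  have h2 : Tendsto (fun X : ℝ => (latticeCount d Y / iota d + Y ^ 2 / 2) / X ^ 2) atTop (𝓝 0) :=
    tendsto_const_nhds.div_atTop (tendsto_pow_atTop two_ne_zero)
  filter_upwards [h2.eventually_le_const he, eventually_gt_atTop 0] with X hX hX0 r hr hr1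
  rcases le_total Y (r * X) with h | h
  · have h3 := hY₀ (r * X) ((le_max_left _ _).trans h)
    have hrX : 0 < r * X := hY.trans_le h
    rw [Real.dist_eq] at h3
    have hr0 : 0 < r := by by_contra hc; have : r = 0 := by linarith
                           simp [this] at hrX
    have h4 : latticeCount d (r * X) / (iota d * X ^ 2) - r ^ 2 / 2 =
        r ^ 2 / iota d * (latticeCount d (r * X) / (r * X) ^ 2 - iota d / 2) := by
      field_simp
    rw [h4, abs_mul, abs_of_pos (by positivity)]
    calc r ^ 2 / iota d * |latticeCount d (r * X) / (r * X) ^ 2 - iota d / 2|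
        ≤ 1 / iota d * (e * iota d) := by
          gcongr
          nlinarith
      _ = e := by field_simp
  · have h3 : (latticeCount d (r * X) : ℝ) ≤ latticeCount d Y := by
      exact_mod_cast latticeCount_mono hd h
    have h4 : (latticeCount d (r * X) : ℝ) / (iota d * X ^ 2) ≤
        latticeCount d Y / iota d / X ^ 2 := by
      rw [div_div]; gcongr
    have h5 : r ^ 2 / 2 ≤ Y ^ 2 / 2 / X ^ 2 := by
      rw [le_div_iff₀ (by positivity)]
      have : (r * X) ^ 2 ≤ Y ^ 2 := by gcongr
      linarith [mul_pow r X 2]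
    rw [add_div] at hX
    have h6 : 0 ≤ (latticeCount d (r * X) : ℝ) / (iota d * X ^ 2) := by positivity
    have h7 : 0 ≤ r ^ 2 / 2 := by positivity
    rw [abs_le]
    constructor <;> linarith


/-! ### The one-loop sum -/

theorem integral_inv_sq {u a : ℝ} (ha : a ≤ 1) (hu : ∀ r ∈ Set.Icc a 1, r + u ≠ 0) :
    ∫ r in a..1, ((r + u) ^ 2)⁻¹ = (a + u)⁻¹ - (1 + u)⁻¹ := by
  have h1 : ∀ r ∈ Set.uIcc a 1, HasDerivAt (fun r : ℝ => -(r + u)⁻¹) ((r + u) ^ 2)⁻¹ r := by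
    intro r hr
    rw [Set.uIcc_of_le ha] at hr
    have := (((hasDerivAt_id r).add_const u).inv (hu r hr)).neg
    refine this.congr_deriv ?_
    simp [div_eq_mul_inv]
  rw [intervalIntegral.integral_eq_sub_of_hasDerivAt h1]
  · ring
  · refine ContinuousOn.intervalIntegrable ?_
    rw [Set.uIcc_of_le ha]
    exact ContinuousOn.inv₀ (by fun_prop) fun r hr => pow_ne_zero 2 (hu r hr)

theorem integral_sq_div_sq {u : ℝ} (hu : ∀ r ∈ Set.Icc (0 : ℝ) 1, r + u ≠ 0) :
    ∫ r in (0 : ℝ)..1, r ^ 2 / 2 * ((r + u) ^ 2)⁻¹ = omegaPrime u - 1 / 2 * (1 + u)⁻¹ := by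
  have h0 : u ≠ 0 := by simpa using hu 0 (by simp)
  have h1u : 1 + u ≠ 0 := hu 1 (by simp)
  have h1 : ∀ r ∈ Set.uIcc (0 : ℝ) 1,
      HasDerivAt (fun r : ℝ => 1 / 2 * (r - 2 * u * Real.log (r + u) - u ^ 2 * (r + u)⁻¹))
        (r ^ 2 / 2 * ((r + u) ^ 2)⁻¹) r := by
    intro r hr
    rw [Set.uIcc_of_le zero_le_one] at hr
    have hr0 := hu r hr
    have ha := (hasDerivAt_id r).add_const u
    have := (((hasDerivAt_id r).sub ((ha.log hr0).const_mul (2 * u))).sub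
      ((ha.inv hr0).const_mul (u ^ 2))).const_mul (1 / 2)
    refine this.congr_deriv ?_
    simp only [id]
    field_simp
    ring
  rw [intervalIntegral.integral_eq_sub_of_hasDerivAt h1]
  · rw [omegaPrime, Real.log_div h1u h0, zero_add]
    field_simp
    ring
  · refine ContinuousOn.intervalIntegrable ?_
    rw [Set.uIcc_of_le zero_le_one]
    exact ContinuousOn.mul (by fun_prop)
      (ContinuousOn.inv₀ (by fun_prop) fun r hr => pow_ne_zero 2 (hu r hr))

/-- A sum of `1 / (ρ + u)` over points `ρ ∈ [0, 1]` whose distribution function is close to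
`r² / 2` is close to `ω'(u)`. -/
theorem abs_sum_inv_sub_omegaPrime_le {α : Type*} (S : Finset α) (ρ : α → ℝ)
    (hρ : ∀ q ∈ S, 0 ≤ ρ q ∧ ρ q ≤ 1) {w e κ u : ℝ} (hκ : 0 < κ)
    (hu : ∀ r ∈ Set.Icc (0 : ℝ) 1, κ ≤ |r + u|)
    (h : ∀ r ∈ Set.Icc (0 : ℝ) 1, |w * (S.filter fun q => ρ q ≤ r).card - r ^ 2 / 2| ≤ e) :
    |w * ∑ q ∈ S, (ρ q + u)⁻¹ - omegaPrime u| ≤ e * (1 / κ + 1 / κ ^ 2) := by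
  have hu0 : ∀ r ∈ Set.Icc (0 : ℝ) 1, r + u ≠ 0 := fun r hr h0 => by
    have := hu r hr
    rw [h0, abs_zero] at this
    linarith
  have he : 0 ≤ e := (abs_nonneg _).trans (h 0 (by simp))
  have hgc : ContinuousOn (fun r : ℝ => ((r + u) ^ 2)⁻¹) (Set.Icc 0 1) :=
    ContinuousOn.inv₀ (by fun_prop) fun r hr => pow_ne_zero 2 (hu0 r hr)
  have hgi : IntegrableOn (fun r : ℝ => ((r + u) ^ 2)⁻¹) (Set.Icc 0 1) :=
    hgc.integrableOn_compact isCompact_Icc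
  have hind : ∀ q, IntegrableOn ((Set.Ici (ρ q)).indicator fun r : ℝ => ((r + u) ^ 2)⁻¹)
      (Set.Icc 0 1) := fun q => hgi.indicator measurableSet_Ici
  have hq : ∀ q ∈ S, (ρ q + u)⁻¹ = (1 + u)⁻¹ +
      ∫ r in Set.Icc (0 : ℝ) 1, (Set.Ici (ρ q)).indicator (fun r : ℝ => ((r + u) ^ 2)⁻¹) r := by
    intro q hq
    have hI : Set.Icc (0 : ℝ) 1 ∩ Set.Ici (ρ q) = Set.Icc (ρ q) 1 := by
      ext r
      simp only [Set.mem_inter_iff, Set.mem_Icc, Set.mem_Ici]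
      have := (hρ q hq).1
      constructor
      · rintro ⟨⟨_, h2⟩, h3⟩; exact ⟨h3, h2⟩
      · rintro ⟨h2, h3⟩; exact ⟨⟨this.trans h2, h3⟩, h2⟩
    rw [setIntegral_indicator measurableSet_Ici, hI, integral_Icc_eq_integral_Ioc,
      ← intervalIntegral.integral_of_le (hρ q hq).2, integral_inv_sq (hρ q hq).2]
    · ring
    · exact fun r hr => hu0 r ⟨(hρ q hq).1.trans hr.1, hr.2⟩
  have hsum : ∀ r, ∑ q ∈ S, (Set.Ici (ρ q)).indicator (fun r : ℝ => ((r + u) ^ 2)⁻¹) r =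
      (S.filter fun q => ρ q ≤ r).card * ((r + u) ^ 2)⁻¹ := by
    intro r
    rw [Finset.card_filter, Nat.cast_sum, Finset.sum_mul]
    refine Finset.sum_congr rfl fun q _ => ?_
    by_cases hqr : ρ q ≤ r <;> simp [Set.indicator, hqr]
  have hall : S.filter (fun q => ρ q ≤ 1) = S := Finset.filter_true_of_mem fun q hq => (hρ q hq).2
  have hNi : IntegrableOn (fun r : ℝ => w * (S.filter fun q => ρ q ≤ r).card * ((r + u) ^ 2)⁻¹)
      (Set.Icc 0 1) := by
    have := (integrable_finsetSum S fun q _ => hind q).const_mul w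
    refine this.congr (ae_of_all _ fun r => ?_)
    simp only [hsum]
    ring
  have hsqi : IntegrableOn (fun r : ℝ => r ^ 2 / 2 * ((r + u) ^ 2)⁻¹) (Set.Icc 0 1) :=
    (ContinuousOn.mul (by fun_prop) hgc).integrableOn_compact isCompact_Icc
  have h1 : w * ∑ q ∈ S, (ρ q + u)⁻¹ = w * (S.filter fun q => ρ q ≤ 1).card * (1 + u)⁻¹ +
      ∫ r in Set.Icc (0 : ℝ) 1, w * (S.filter fun q => ρ q ≤ r).card * ((r + u) ^ 2)⁻¹ := by
    rw [Finset.sum_congr rfl hq, Finset.sum_add_distrib, Finset.sum_const, nsmul_eq_mul, hall,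
      ← integral_finsetSum S fun q _ => hind q]
    simp_rw [hsum, mul_assoc]
    rw [integral_const_mul, mul_add]
  have h2 : omegaPrime u = 1 / 2 * (1 + u)⁻¹ +
      ∫ r in Set.Icc (0 : ℝ) 1, r ^ 2 / 2 * ((r + u) ^ 2)⁻¹ := by
    rw [integral_Icc_eq_integral_Ioc, ← intervalIntegral.integral_of_le zero_le_one,
      integral_sq_div_sq hu0]
    ring
  have h3 : w * ∑ q ∈ S, (ρ q + u)⁻¹ - omegaPrime u =
      (w * (S.filter fun q => ρ q ≤ 1).card - 1 / 2) * (1 + u)⁻¹ +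
      ∫ r in Set.Icc (0 : ℝ) 1,
        (w * (S.filter fun q => ρ q ≤ r).card - r ^ 2 / 2) * ((r + u) ^ 2)⁻¹ := by
    simp_rw [sub_mul]
    rw [integral_sub hNi hsqi, h1, h2]
    ring
  have h4 : ‖∫ r in Set.Icc (0 : ℝ) 1,
        (w * (S.filter fun q => ρ q ≤ r).card - r ^ 2 / 2) * ((r + u) ^ 2)⁻¹‖ ≤
        e * (1 / κ ^ 2) * volume.real (Set.Icc (0 : ℝ) 1) := by
    refine norm_setIntegral_le_of_norm_le_const (by simp) fun r hr => ?_
    rw [Real.norm_eq_abs, abs_mul, abs_inv, abs_pow, one_div]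
    have := hu r hr
    gcongr
    exact h r hr
  rw [Real.volume_real_Icc_of_le zero_le_one, sub_zero, mul_one, Real.norm_eq_abs] at h4
  have h5 : |(w * (S.filter fun q => ρ q ≤ 1).card - 1 / 2) * (1 + u)⁻¹| ≤ e * (1 / κ) := by
    have h6 := hu 1 (by simp)
    have h7 := h 1 (by simp)
    rw [one_pow] at h7
    rw [abs_mul, abs_inv, one_div κ]
    gcongr
  rw [h3]
  refine (abs_add_le _ _).trans ?_
  linarith

theorem hasDerivAt_omegaPrime {x : ℝ} (hx : 0 < (1 + x) / x) :
    HasDerivAt omegaPrime ((1 + x)⁻¹ - Real.log ((1 + x) / x)) x := by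
  have h0 : x ≠ 0 := by rintro rfl; simp at hx
  have h1 : 1 + x ≠ 0 := by intro h; simp [h] at hx
  have hd := ((hasDerivAt_id x).const_add 1).div (hasDerivAt_id x) h0
  have := ((hasDerivAt_id x).mul (hd.log hx.ne')).const_sub 1
  refine this.congr_deriv ?_
  simp only [id, Pi.div_apply]
  field_simp
  ring

theorem omegaPrime_antitoneOn {D : Set ℝ} (hD : Convex ℝ D) (hx : ∀ x ∈ D, 0 < (1 + x) / x) :
    AntitoneOn omegaPrime D := by
  refine antitoneOn_of_hasDerivWithinAt_nonpos
    (f' := fun x => (1 + x)⁻¹ - Real.log ((1 + x) / x)) hD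
    (fun x h => (hasDerivAt_omegaPrime (hx x h)).continuousAt.continuousWithinAt)
    (fun x h => (hasDerivAt_omegaPrime (hx x (interior_subset h))).hasDerivWithinAt) fun x h => ?_
  have hx := hx x (interior_subset h)
  have h0 : x ≠ 0 := by rintro rfl; simp at hx
  have h1 : 1 + x ≠ 0 := by intro h; simp [h] at hx
  have h2 := Real.one_sub_inv_le_log_of_pos hx
  have h3 : 1 - ((1 + x) / x)⁻¹ = (1 + x)⁻¹ := by field_simp; ring
  linarith


/-! ### Solutions of the rescaled Schwinger-Dyson equation -/

/-- The rescaled denominator `|q|^{2η} / X + μ - (1/d) ∑ᵢ t(qᵢ)`. -/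
noncomputable def scaledDenominator (d : ℕ) (X μ : ℝ) (t : ℤ → ℝ) (q : Fin d → ℤ) : ℝ :=
  momPow d q / X + μ - (∑ i, t (q i)) / d

/-- A solution `t` of the Schwinger-Dyson equation, in units of the cutoff `X = Λ^{2η}`, with
denominators of sign `σ`, when the lattice points are equidistributed up to `e`. -/
structure IsScaledSolution (d : ℕ) (X g μ σ κ e : ℝ) (c : Fin d) (t : ℤ → ℝ) : Prop where
  three_le : 3 ≤ d
  X_pos : 0 < X
  g_pos : 0 < g
  κ_pos : 0 < κ
  abs_σ : |σ| = 1
  gap : ∀ ρ ∈ Set.Icc (0 : ℝ) 1, κ ≤ σ * (ρ + μ)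
  count : ∀ r : ℝ, 0 ≤ r → r ≤ 1 →
    |latticeCount d (r * X) / (iota d * X ^ 2) - r ^ 2 / 2| ≤ e
  e_le : e ≤ 1 / 2
  eq : ∀ p : ℤ, |(p : ℝ)| ^ twoEta d ≤ X → t p = -(2 * g / (iota d * X ^ 2) *
    ∑ q ∈ slice d X c p, (scaledDenominator d X μ t q)⁻¹)
  pos : ∀ q, momPow d q ≤ X → 0 < σ * scaledDenominator d X μ t q

namespace IsScaledSolution

variable {d : ℕ} {X g μ σ κ e : ℝ} {c : Fin d} {t : ℤ → ℝ}

theorem σ_sq (h : IsScaledSolution d X g μ σ κ e c t) : σ * σ = 1 := by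
  rw [← abs_mul_abs_self, h.abs_σ, one_mul]

theorem abs_component_le {q : Fin d → ℤ} (hq : momPow d q ≤ X) (i : Fin d) :
    |(q i : ℝ)| ^ twoEta d ≤ X := (abs_rpow_le_momPow q i).trans hq

theorem σ_mul_inv {x : ℝ} (h : IsScaledSolution d X g μ σ κ e c t) : σ * x⁻¹ = (σ * x)⁻¹ := by
  rw [mul_inv, ← eq_inv_of_mul_eq_one_left h.σ_sq]

theorem weight_pos (h : IsScaledSolution d X g μ σ κ e c t) : 0 < 2 * g / (iota d * X ^ 2) := by
  have := iota_pos h.three_le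
  have := h.X_pos
  have := h.g_pos
  positivity

theorem sign (h : IsScaledSolution d X g μ σ κ e c t) {p : ℤ} (hp : |(p : ℝ)| ^ twoEta d ≤ X) :
    σ * t p ≤ 0 := by
  rw [h.eq p hp, mul_neg, neg_nonpos, mul_left_comm, Finset.mul_sum]
  refine mul_nonneg h.weight_pos.le (Finset.sum_nonneg fun q hq => ?_)
  rw [h.σ_mul_inv]
  exact (inv_pos.2 (h.pos q ((mem_slice h.three_le).1 hq).1)).le

theorem kappa_le (h : IsScaledSolution d X g μ σ κ e c t) {q : Fin d → ℤ} (hq : momPow d q ≤ X) :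
    κ ≤ σ * scaledDenominator d X μ t q := by
  have h1 := h.gap (momPow d q / X) ⟨div_nonneg (momPow_nonneg d q) h.X_pos.le,
    (div_le_one h.X_pos).2 hq⟩
  have h2 : σ * ((∑ i, t (q i)) / d) ≤ 0 := by
    rw [← mul_div_assoc, Finset.mul_sum]
    exact div_nonpos_of_nonpos_of_nonneg
      (Finset.sum_nonpos fun i _ => h.sign (abs_component_le hq i)) (Nat.cast_nonneg d)
  rw [scaledDenominator, mul_sub]
  linarith

theorem kappa_le_abs (h : IsScaledSolution d X g μ σ κ e c t) {q : Fin d → ℤ}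
    (hq : momPow d q ≤ X) : κ ≤ |scaledDenominator d X μ t q| := by
  have := (h.kappa_le hq).trans (le_abs_self _)
  rwa [abs_mul, h.abs_σ, one_mul] at this

theorem card_slice_mul_le (h : IsScaledSolution d X g μ σ κ e c t) (p : ℤ) :
    1 / (iota d * X ^ 2) * (slice d X c p).card ≤ 1 := by
  have h1 : ((slice d X c p).card : ℝ) ≤ latticeCount d X := by
    rw [← card_slice_zero h.three_le X c]
    exact_mod_cast card_slice_le h.three_le X c p
  have h2 := (abs_le.1 (h.count 1 zero_le_one le_rfl)).2
  have := iota_pos h.three_le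
  have := h.X_pos
  rw [one_mul] at h2
  calc 1 / (iota d * X ^ 2) * ((slice d X c p).card : ℝ)
      ≤ 1 / (iota d * X ^ 2) * latticeCount d X := by gcongr
    _ = latticeCount d X / (iota d * X ^ 2) := by ring
    _ ≤ 1 := by linarith [h.e_le]

/-- A sum over a part of a slice is bounded by the supremum. -/
theorem abs_sum_le (h : IsScaledSolution d X g μ σ κ e c t) {p : ℤ} {S : Finset (Fin d → ℤ)}
    (hS : S ⊆ slice d X c p) {F : (Fin d → ℤ) → ℝ} {B : ℝ} (hB : 0 ≤ B) (hF : ∀ q ∈ S, |F q| ≤ B) :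
    |2 * g / (iota d * X ^ 2) * ∑ q ∈ S, F q| ≤ 2 * g * B := by
  have hg := h.g_pos
  have hc := h.card_slice_mul_le p
  have hι := iota_pos h.three_le
  have hX := h.X_pos
  rw [abs_mul, abs_of_pos h.weight_pos]
  have h1 : |∑ q ∈ S, F q| ≤ (slice d X c p).card * B := by
    refine (Finset.abs_sum_le_sum_abs _ _).trans ((Finset.sum_le_sum hF).trans ?_)
    rw [Finset.sum_const, nsmul_eq_mul]
    gcongr
  calc 2 * g / (iota d * X ^ 2) * |∑ q ∈ S, F q|
      ≤ 2 * g / (iota d * X ^ 2) * ((slice d X c p).card * B) := by gcongr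
    _ = 2 * g * B * (1 / (iota d * X ^ 2) * (slice d X c p).card) := by ring
    _ ≤ 2 * g * B * 1 := by gcongr
    _ = 2 * g * B := mul_one _

theorem abs_inv_le (h : IsScaledSolution d X g μ σ κ e c t) {q : Fin d → ℤ}
    (hq : momPow d q ≤ X) : |(scaledDenominator d X μ t q)⁻¹| ≤ 1 / κ := by
  have hκ := h.κ_pos
  rw [abs_inv, one_div]
  gcongr
  exact h.kappa_le_abs hq

theorem abs_le (h : IsScaledSolution d X g μ σ κ e c t) {p : ℤ} (hp : |(p : ℝ)| ^ twoEta d ≤ X) :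
    |t p| ≤ 2 * g / κ := by
  rw [h.eq p hp, abs_neg]
  have := h.abs_sum_le (p := p) (Finset.Subset.refl _) (one_div_pos.2 h.κ_pos).le
    fun q hq => h.abs_inv_le ((mem_slice h.three_le).1 hq).1
  rwa [mul_one_div] at this

theorem abs_inv_sub_inv_le {x y κ : ℝ} (hκ : 0 < κ) (hx : κ ≤ |x|) (hy : κ ≤ |y|) :
    |x⁻¹ - y⁻¹| ≤ |x - y| / κ ^ 2 := by
  have hx0 : x ≠ 0 := by rintro rfl; simp at hx; linarith
  have hy0 : y ≠ 0 := by rintro rfl; simp at hy; linarith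
  rw [inv_sub_inv hx0 hy0, abs_div, abs_mul, abs_sub_comm]
  gcongr
  nlinarith

theorem sum_slice_eq (hd : 3 ≤ d) (p : ℤ) (F : (Fin d → ℤ) → ℝ) :
    ∑ q ∈ slice d X c p, F q =
      ∑ q ∈ slice d (X - |(p : ℝ)| ^ twoEta d) c 0, F (Function.update q c p) := by
  symm
  refine Finset.sum_bij' (fun q _ => Function.update q c p) (fun q _ => Function.update q c 0)
    ?_ ?_ ?_ ?_ ?_
  · intro q hq
    have hq := (mem_slice hd).1 hq
    refine (mem_slice hd).2 ⟨?_, Function.update_self ..⟩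
    rw [momPow_update hd q c hq.2]
    linarith [hq.1]
  · intro q hq
    have hq := (mem_slice hd).1 hq
    refine (mem_slice hd).2 ⟨?_, Function.update_self ..⟩
    have h := momPow_update hd (Function.update q c 0) c (Function.update_self ..) p
    rw [Function.update_idem, ← hq.2, Function.update_eq_self] at h
    rw [← hq.2]
    linarith [hq.1]
  · intro q hq
    have hq := ((mem_slice hd).1 hq).2
    rw [Function.update_idem, ← hq, Function.update_eq_self]
  · intro q hq
    have hq := ((mem_slice hd).1 hq).2
    rw [Function.update_idem, ← hq, Function.update_eq_self]
  · intro q hq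
    rfl

theorem scaledDenominator_update (hd : 3 ≤ d) {q : Fin d → ℤ} (hq : q c = 0) (p : ℤ) :
    scaledDenominator d X μ t (Function.update q c p) - scaledDenominator d X μ t q =
      |(p : ℝ)| ^ twoEta d / X - (t p - t 0) / d := by
  have h1 : ∑ i, t (Function.update q c p i) = ∑ i, t (q i) + (t p - t 0) := by
    rw [← Finset.add_sum_erase _ _ (Finset.mem_univ c),
      ← Finset.add_sum_erase (a := c) _ (fun i => t (q i)) (Finset.mem_univ c)]
    rw [Function.update_self, hq]
    have : ∑ i ∈ Finset.univ.erase c, t (Function.update q c p i) =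
        ∑ i ∈ Finset.univ.erase c, t (q i) := by
      refine Finset.sum_congr rfl fun i hi => ?_
      rw [Function.update_of_ne (Finset.ne_of_mem_erase hi)]
    rw [this]
    ring
  rw [scaledDenominator, scaledDenominator, h1, momPow_update hd q c hq]
  ring

theorem zero_le (h : IsScaledSolution d X g μ σ κ e c t) : |((0 : ℤ) : ℝ)| ^ twoEta d ≤ X := by
  have hs : twoEta d ≠ 0 := by linarith [one_le_twoEta h.three_le]
  simpa [Real.zero_rpow hs] using h.X_pos.le

/-- At momenta well below the cutoff, `t` is close to its value at `0`. -/
theorem abs_sub_le (h : IsScaledSolution d X g μ σ κ e c t) {p : ℤ} {δ : ℝ} (hδ : δ ≤ 1)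
    (hp : |(p : ℝ)| ^ twoEta d ≤ δ * X) :
    |t p - t 0| ≤ 2 * g * ((δ + 4 * g / κ / d) / κ ^ 2) + 2 * g * (δ + 2 * e) / κ := by
  have hd := h.three_le
  have hg := h.g_pos
  have hκ := h.κ_pos
  have hX := h.X_pos
  have hι := iota_pos hd
  have hp0 : 0 ≤ |(p : ℝ)| ^ twoEta d := Real.rpow_nonneg (abs_nonneg _) _
  have hδ0 : 0 ≤ δ := by
    by_contra hc
    push Not at hc
    nlinarith
  have hp1 : |(p : ℝ)| ^ twoEta d ≤ X := by nlinarith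
  set S := slice d X c 0 with hSdef
  set S' := slice d (X - |(p : ℝ)| ^ twoEta d) c 0 with hS'def
  have hsub : S' ⊆ S := by
    intro q hq
    have hq := (mem_slice hd).1 hq
    exact (mem_slice hd).2 ⟨by linarith [hq.1], hq.2⟩
  set D := scaledDenominator d X μ t with hD
  set w := 2 * g / (iota d * X ^ 2) with hw
  have hmain : t p - t 0 =
      -(w * ∑ q ∈ S', ((D (Function.update q c p))⁻¹ - (D q)⁻¹)) + w * ∑ q ∈ S \ S', (D q)⁻¹ := by
    rw [h.eq p hp1, h.eq 0 h.zero_le, sum_slice_eq hd, Finset.sum_sub_distrib, ← hSdef, ← hS'def,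
      ← Finset.sum_sdiff hsub]
    ring
  have h1 : |w * ∑ q ∈ S', ((D (Function.update q c p))⁻¹ - (D q)⁻¹)| ≤
      2 * g * ((δ + 4 * g / κ / d) / κ ^ 2) := by
    refine h.abs_sum_le hsub (by positivity) fun q hq => ?_
    have hq := (mem_slice hd).1 hq
    have hu : momPow d (Function.update q c p) ≤ X := by
      rw [momPow_update hd q c hq.2]; linarith [hq.1]
    have hq1 : momPow d q ≤ X := by linarith [hq.1]
    refine (abs_inv_sub_inv_le hκ (h.kappa_le_abs hu) (h.kappa_le_abs hq1)).trans ?_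
    gcongr
    rw [scaledDenominator_update hd hq.2]
    have h2 : |(|(p : ℝ)| ^ twoEta d / X)| ≤ δ := by
      rw [abs_of_nonneg (by positivity), div_le_iff₀ hX]
      exact hp
    have h3 : |(t p - t 0) / d| ≤ 4 * g / κ / d := by
      rw [abs_div, Nat.abs_cast]
      gcongr
      have h4 := (abs_sub (t p) (t 0)).trans (add_le_add (h.abs_le hp1) (h.abs_le h.zero_le))
      calc |t p - t 0| ≤ 2 * g / κ + 2 * g / κ := h4
        _ = 4 * g / κ := by ring
    exact (abs_sub _ _).trans (add_le_add h2 h3)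
  have h2 : |w * ∑ q ∈ S \ S', (D q)⁻¹| ≤ 2 * g * (δ + 2 * e) / κ := by
    have h3 : |∑ q ∈ S \ S', (D q)⁻¹| ≤ (S \ S').card * (1 / κ) := by
      refine (Finset.abs_sum_le_sum_abs _ _).trans ((Finset.sum_le_sum fun q hq =>
        h.abs_inv_le ((mem_slice hd).1 (Finset.mem_sdiff.1 hq).1).1).trans ?_)
      rw [Finset.sum_const, nsmul_eq_mul]
    have h4 : ((S \ S').card : ℝ) ≤ latticeCount d (1 * X) - latticeCount d ((1 - δ) * X) := by
      rw [Finset.card_sdiff_of_subset hsub, Nat.cast_sub (Finset.card_le_card hsub), hSdef, hS'def,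
        card_slice_zero hd, card_slice_zero hd, one_mul]
      have : (latticeCount d ((1 - δ) * X) : ℝ) ≤ latticeCount d (X - |(p : ℝ)| ^ twoEta d) := by
        exact Nat.cast_le.2 (latticeCount_mono hd (by linarith))
      linarith
    have h5 := (_root_.abs_le.1 (h.count 1 zero_le_one le_rfl)).2
    have h6 := (_root_.abs_le.1 (h.count (1 - δ) (by linarith) (by linarith))).1
    have h7 : ((S \ S').card : ℝ) / (iota d * X ^ 2) ≤ δ + 2 * e := by
      have : ((S \ S').card : ℝ) / (iota d * X ^ 2) ≤
        (latticeCount d (1 * X) - latticeCount d ((1 - δ) * X)) / (iota d * X ^ 2) := by gcongr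
      rw [sub_div] at this
      nlinarith
    rw [abs_mul, abs_of_pos h.weight_pos]
    calc w * |∑ q ∈ S \ S', (D q)⁻¹| ≤ w * ((S \ S').card * (1 / κ)) := by
          gcongr
      _ = 2 * g * (((S \ S').card : ℝ) / (iota d * X ^ 2)) / κ := by rw [hw]; ring
      _ ≤ 2 * g * (δ + 2 * e) / κ := by gcongr
  rw [hmain]
  refine (abs_add_le _ _).trans ?_
  rw [abs_neg]
  exact add_le_add h1 h2

/-- The average of `t` over the components of any momentum is close to `t 0`, since only few
components can be large. -/
theorem abs_average_sub_le (h : IsScaledSolution d X g μ σ κ e c t) {δ K : ℝ} (hδ : 0 < δ)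
    (hK0 : 0 ≤ K)
    (hK : ∀ p : ℤ, |(p : ℝ)| ^ twoEta d ≤ δ * X → |t p - t 0| ≤ K) {q : Fin d → ℤ}
    (hq : momPow d q ≤ X) :
    |(∑ i, t (q i)) / d - t 0| ≤ K + 4 * g / κ / (δ * d) := by
  have hd := h.three_le
  have hd0 : (0 : ℝ) < d := by
    have : 0 < d := by omega
    exact_mod_cast this
  have hg := h.g_pos
  have hκ := h.κ_pos
  have hX := h.X_pos
  set bad := Finset.univ.filter fun i => δ * X < |(q i : ℝ)| ^ twoEta d with hbad
  have hcard : (bad.card : ℝ) ≤ 1 / δ := by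
    have h1 : bad.card * (δ * X) ≤ X := by
      calc bad.card * (δ * X) = ∑ i ∈ bad, δ * X := by rw [Finset.sum_const, nsmul_eq_mul]
        _ ≤ ∑ i ∈ bad, |(q i : ℝ)| ^ twoEta d :=
            Finset.sum_le_sum fun i hi => (Finset.mem_filter.1 hi).2.le
        _ ≤ momPow d q := Finset.sum_le_sum_of_subset_of_nonneg (Finset.subset_univ _)
            fun i _ _ => Real.rpow_nonneg (abs_nonneg _) _
        _ ≤ X := hq
    rw [le_div_iff₀ hδ]
    by_contra hc
    push Not at hc
    nlinarith
  have h1 : (∑ i, t (q i)) / d - t 0 = (∑ i, (t (q i) - t 0)) / d := by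
    rw [Finset.sum_sub_distrib]
    simp only [Finset.sum_const, Finset.card_univ, Fintype.card_fin, nsmul_eq_mul]
    field_simp
  have h2 : ∀ i, |t (q i) - t 0| ≤ K + if i ∈ bad then 4 * g / κ else 0 := by
    intro i
    by_cases hi : i ∈ bad
    · rw [if_pos hi]
      have h4 := (abs_sub (t (q i)) (t 0)).trans
        (add_le_add (h.abs_le (abs_component_le hq i)) (h.abs_le h.zero_le))
      have : 2 * g / κ + 2 * g / κ = 4 * g / κ := by ring
      linarith
    · rw [if_neg hi, add_zero]
      refine hK _ ?_
      by_contra hc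
      exact hi (Finset.mem_filter.2 ⟨Finset.mem_univ i, not_le.1 hc⟩)
  have h3 : |∑ i, (t (q i) - t 0)| ≤ d * K + 1 / δ * (4 * g / κ) := by
    refine (Finset.abs_sum_le_sum_abs _ _).trans ((Finset.sum_le_sum fun i _ => h2 i).trans ?_)
    rw [Finset.sum_add_distrib, ← Finset.sum_filter]
    simp only [Finset.sum_const, Finset.card_univ, Fintype.card_fin, nsmul_eq_mul,
      Finset.filter_mem_eq_inter, Finset.univ_inter]
    gcongr
  rw [h1, abs_div, Nat.abs_cast, div_le_iff₀ hd0]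
  refine h3.trans (le_of_eq ?_)
  field_simp

/-- The effective mass `u = μ - t 0` almost solves the limit equation `u = μ + 2 g ω'(u)`. -/
theorem abs_fixed_point_le (h : IsScaledSolution d X g μ σ κ e c t) {ε : ℝ}
    (hε : ∀ q, momPow d q ≤ X → |(∑ i, t (q i)) / d - t 0| ≤ ε) :
    |(μ - t 0) - μ - 2 * g * omegaPrime (μ - t 0)| ≤
      2 * g * (ε / κ ^ 2) + 2 * g * (e * (1 / κ + 1 / κ ^ 2)) := by
  have hd := h.three_le
  have hg := h.g_pos
  have hκ := h.κ_pos
  have hX := h.X_pos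
  have hι := iota_pos hd
  have hε0 : 0 ≤ ε := (abs_nonneg _).trans (hε 0 (by
    have hs : twoEta d ≠ 0 := by linarith [one_le_twoEta hd]
    simpa [momPow, Real.zero_rpow hs] using hX.le))
  set u := μ - t 0 with hu
  set D := scaledDenominator d X μ t with hD
  have hgap : ∀ r ∈ Set.Icc (0 : ℝ) 1, κ ≤ |r + u| := by
    intro r hr
    have h1 : κ ≤ σ * (r + u) := by
      have h2 : σ * (r + u) = σ * (r + μ) - σ * t 0 := by rw [hu]; ring
      linarith [h.gap r hr, h.sign h.zero_le]
    have := h1.trans (le_abs_self _)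
    rwa [abs_mul, h.abs_σ, one_mul] at this
  set S := slice d X c 0 with hS
  have hρ : ∀ q ∈ S, 0 ≤ momPow d q / X ∧ momPow d q / X ≤ 1 := fun q hq =>
    ⟨div_nonneg (momPow_nonneg d q) hX.le, (div_le_one hX).2 ((mem_slice hd).1 hq).1⟩
  have hR := abs_sum_inv_sub_omegaPrime_le S (fun q => momPow d q / X) hρ
    (w := 1 / (iota d * X ^ 2)) hκ hgap (e := e) (by
      intro r hr
      have : S.filter (fun q => momPow d q / X ≤ r) = slice d (r * X) c 0 := by
        ext q
        rw [Finset.mem_filter, mem_slice hd, mem_slice hd, div_le_iff₀ hX]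
        constructor
        · rintro ⟨⟨_, h2⟩, h3⟩; exact ⟨h3, h2⟩
        · rintro ⟨h1, h2⟩; exact ⟨⟨h1.trans (by nlinarith [hr.2]), h2⟩, h1⟩
      rw [this, card_slice_zero hd, one_div_mul_eq_div]
      exact h.count r hr.1 hr.2)
  have h1 : |2 * g / (iota d * X ^ 2) * ∑ q ∈ S, ((D q)⁻¹ - (momPow d q / X + u)⁻¹)| ≤
      2 * g * (ε / κ ^ 2) := by
    refine h.abs_sum_le (Finset.Subset.refl _) (by positivity) fun q hq => ?_
    have hq1 := ((mem_slice hd).1 hq).1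
    refine (abs_inv_sub_inv_le hκ (h.kappa_le_abs hq1) (hgap _ (hρ q hq))).trans ?_
    gcongr
    have h2 : D q - (momPow d q / X + u) = -((∑ i, t (q i)) / d - t 0) := by
      rw [hD, scaledDenominator, hu]; ring
    rw [h2, abs_neg]
    exact hε q hq1
  have h3 : u - μ - 2 * g * omegaPrime u =
      2 * g / (iota d * X ^ 2) * ∑ q ∈ S, ((D q)⁻¹ - (momPow d q / X + u)⁻¹) +
      2 * g * (1 / (iota d * X ^ 2) * ∑ q ∈ S, (momPow d q / X + u)⁻¹ - omegaPrime u) := by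
    have : u - μ = 2 * g / (iota d * X ^ 2) * ∑ q ∈ S, (D q)⁻¹ := by
      rw [hu, h.eq 0 h.zero_le]; ring
    rw [this, Finset.sum_sub_distrib]
    ring
  rw [h3]
  refine (abs_add_le _ _).trans (add_le_add h1 ?_)
  rw [abs_mul, abs_of_pos (by positivity)]
  gcongr

end IsScaledSolution


/-! ### The model as a rescaled solution -/

theorem sameSign_propagator {d : ℕ} {Λ μ σ κ : ℝ} (hX : 0 < Λ ^ twoEta d) (hκ : 0 < κ)
    (hσ : |σ| = 1) (gap : ∀ ρ ∈ Set.Icc (0 : ℝ) 1, κ ≤ σ * (ρ + μ)) :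
    SameSign d Λ (μ * Λ ^ twoEta d) σ ∧ ∀ q, momPow d q ≤ Λ ^ twoEta d →
      κ * Λ ^ twoEta d ≤ |momPow d q + μ * Λ ^ twoEta d| ∧
      propagator d Λ (μ * Λ ^ twoEta d) q ≠ 0 := by
  have hσ2 : σ * σ = 1 := by rw [← abs_mul_abs_self, hσ, one_mul]
  have key : ∀ q, momPow d q ≤ Λ ^ twoEta d →
      κ * Λ ^ twoEta d ≤ σ * (momPow d q + μ * Λ ^ twoEta d) := by
    intro q hq
    have h1 := gap (momPow d q / Λ ^ twoEta d)
      ⟨div_nonneg (momPow_nonneg d q) hX.le, (div_le_one hX).2 hq⟩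
    have h2 : σ * (momPow d q + μ * Λ ^ twoEta d) =
        σ * (momPow d q / Λ ^ twoEta d + μ) * Λ ^ twoEta d := by field_simp
    rw [h2]
    gcongr
  have habs : ∀ q, momPow d q ≤ Λ ^ twoEta d →
      |momPow d q + μ * Λ ^ twoEta d| = σ * (momPow d q + μ * Λ ^ twoEta d) := by
    intro q hq
    have h1 : 0 ≤ σ * (momPow d q + μ * Λ ^ twoEta d) := (by positivity : (0:ℝ) ≤ _).trans (key q hq)
    rw [← abs_of_nonneg h1, abs_mul, hσ, one_mul]
  refine ⟨⟨hσ, fun q => ?_⟩, fun q hq => ⟨(habs q hq).symm ▸ key q hq, ?_⟩⟩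
  · by_cases hq : momPow d q ≤ Λ ^ twoEta d
    · rw [propagator_of_mem hq, abs_inv, habs q hq, mul_inv, ← mul_assoc,
        mul_inv_cancel₀ (by rintro rfl; simp at hσ), one_mul]
    · simp [propagator, hq]
  · rw [propagator_of_mem hq]
    have h1 := key q hq
    have h2 : 0 < κ * Λ ^ twoEta d := by positivity
    intro h0
    rw [inv_eq_zero.1 h0, mul_zero] at h1
    linarith

theorem isScaledSolution_tau {d : ℕ} (hd : 3 ≤ d) {Λ g μ σ κ e : ℝ} (hΛ : 0 < Λ) (hg : 0 < g)
    (hκ : 0 < κ) (hσ : |σ| = 1) (gap : ∀ ρ ∈ Set.Icc (0 : ℝ) 1, κ ≤ σ * (ρ + μ))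
    (count : ∀ r : ℝ, 0 ≤ r → r ≤ 1 → |latticeCount d (r * Λ ^ twoEta d) /
      (iota d * (Λ ^ twoEta d) ^ 2) - r ^ 2 / 2| ≤ e) (he : e ≤ 1 / 2) {c : Fin d}
    (hconv : MelonicSeriesConverges d Λ g μ c) :
    IsScaledSolution d (Λ ^ twoEta d) g μ σ κ e c fun p =>
      d * (tau Λ (μ * Λ ^ twoEta d) (coupling d g) c p / Λ ^ twoEta d) := by
  have hX : 0 < Λ ^ twoEta d := Real.rpow_pos_of_pos hΛ _
  have hι := iota_pos hd
  have hd0 : (0 : ℝ) < d := by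
    have : 0 < d := by omega
    exact_mod_cast this
  have hlam : coupling d g ≠ 0 := by unfold coupling; positivity
  obtain ⟨hs, hC⟩ := sameSign_propagator hX hκ hσ gap
  have hC' := fun q hq => (hC q hq).2
  have hsum := summable_melonicTerm hd hΛ.le hs hlam hC' hconv
  have hden : ∀ q : Fin d → ℤ, scaledDenominator d (Λ ^ twoEta d) μ (fun p =>
      d * (tau Λ (μ * Λ ^ twoEta d) (coupling d g) c p / Λ ^ twoEta d)) q =
      denominator Λ (μ * Λ ^ twoEta d) (coupling d g) q / Λ ^ twoEta d := by
    intro q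
    rw [scaledDenominator, denominator, ← Finset.mul_sum, ← Finset.sum_div,
      Finset.sum_congr rfl fun i _ => tau_colour Λ (μ * Λ ^ twoEta d) (coupling d g) c i (q i)]
    field_simp
  refine ⟨hd, hX, hg, hκ, hσ, gap, count, he, fun p hp => ?_, fun q hq => ?_⟩
  · simp only [hden, inv_div]
    rw [tau_eq_sum hd hs hlam hC' (hsum c p hp), coupling]
    simp only [div_eq_mul_inv, ← Finset.mul_sum]
    field_simp
  · rw [hden, ← mul_div_assoc]
    have h1 := (abs_rpow_le_momPow q c).trans hq
    exact div_pos (denominator_sign hd hs hlam hq (hC' q hq) (hsum c (q c) h1)) hX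

theorem effectiveMassTendsTo_of_fixed_point {g μ σ κ u : ℝ} (hg : 0 < g)
    (hκ : 0 < κ) (hσ : |σ| = 1) (gap : ∀ ρ ∈ Set.Icc (0 : ℝ) 1, κ ≤ σ * (ρ + μ))
    {D : Set ℝ} (hD : AntitoneOn omegaPrime D) (huD : u ∈ D)
    (hmem : ∀ x, σ * μ ≤ σ * x → x ∈ D) (hu : u = μ + 2 * g * omegaPrime u) :
    EffectiveMassTendsTo g μ u := by
  intro ε hε
  set E : ℝ → ℝ → ℝ := fun η x => 2 * g * ((2 * g * ((η + 4 * g / κ * x) / κ ^ 2) +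
    2 * g * (η + 2 * η) / κ + 4 * g / κ * (x / η)) / κ ^ 2) +
    2 * g * (η * (1 / κ + 1 / κ ^ 2)) with hE
  obtain ⟨η, hη, hη0, hη1⟩ : ∃ η, E η 0 < ε ∧ 0 < η ∧ η ≤ 1 / 2 := by
    have h1 : Tendsto (fun η => 2 * g * ((2 * g * (η / κ ^ 2) +
        2 * g * (η + 2 * η) / κ) / κ ^ 2) +
        2 * g * (η * (1 / κ + 1 / κ ^ 2))) (𝓝 (0 : ℝ)) (𝓝 0) := by
      refine Continuous.tendsto' (by fun_prop) _ _ (by simp)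
    have h2 := (h1.mono_left nhdsWithin_le_nhds).eventually_lt_const (l := 𝓝[>] (0:ℝ)) hε
    obtain ⟨η, h3, h4⟩ := (h2.and (Ioc_mem_nhdsGT (by norm_num : (0 : ℝ) < 1 / 2))).exists
    exact ⟨η, by simpa [hE] using h3, h4.1, h4.2⟩
  have hlim : Tendsto (fun d : ℕ => E η (1 / d)) atTop (𝓝 (E η 0)) := by
    have h1 : Continuous (E η) := by
      simp only [hE]
      fun_prop
    exact (h1.tendsto 0).comp tendsto_one_div_atTop_nhds_zero_nat
  filter_upwards [hlim.eventually_lt_const hη, eventually_ge_atTop 3] with d hdε hd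
  have hX : Tendsto (fun Λ : ℝ => Λ ^ twoEta d) atTop atTop :=
    tendsto_rpow_atTop (by linarith [one_le_twoEta hd])
  filter_upwards [hX.eventually (eventually_latticeCount hd hη0), eventually_gt_atTop 0]
    with Λ hcount hΛ c hconv
  have hsol := isScaledSolution_tau hd hΛ hg hκ hσ gap hcount hη1 hconv
  set t : ℤ → ℝ := fun p =>
    d * (tau Λ (μ * Λ ^ twoEta d) (coupling d g) c p / Λ ^ twoEta d) with ht
  have hmass : effectiveMass d Λ g μ c = μ - t 0 := rfl
  have hb := hsol.abs_fixed_point_le fun q hq => hsol.abs_average_sub_le hη0 (by positivity)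
    (fun p hp => hsol.abs_sub_le (by linarith) hp) hq
  rw [hmass]
  set v := μ - t 0 with hv
  have hvD : v ∈ D := hmem v (by
    have := hsol.sign hsol.zero_le
    rw [hv, mul_sub]
    linarith)
  refine lt_of_le_of_lt ?_ hdε
  refine le_trans ?_ (hb.trans (le_of_eq ?_))
  · rcases le_total u v with h | h
    · have := hD huD hvD h
      rw [abs_of_nonneg (sub_nonneg.2 h)]
      refine le_trans ?_ (le_abs_self _)
      nlinarith
    · have := hD hvD huD h
      rw [abs_of_nonpos (sub_nonpos.2 h)]
      refine le_trans ?_ (neg_le_abs _)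
      nlinarith
  · simp only [hE]
    field_simp

theorem melonicSeriesConverges_of_small {g μ σ κ : ℝ} (hg : 0 < g) (hgκ : 8 * g ≤ κ ^ 2)
    (hκ : 0 < κ) (hσ : |σ| = 1) (gap : ∀ ρ ∈ Set.Icc (0 : ℝ) 1, κ ≤ σ * (ρ + μ)) :
    ∀ᶠ d : ℕ in atTop, ∀ᶠ Λ : ℝ in atTop, ∀ c : Fin d, MelonicSeriesConverges d Λ g μ c := by
  filter_upwards [eventually_ge_atTop 3] with d hd
  have hlimX : Tendsto (fun Λ : ℝ => Λ ^ twoEta d) atTop atTop :=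
    tendsto_rpow_atTop (by linarith [one_le_twoEta hd])
  filter_upwards [hlimX.eventually (eventually_latticeCount hd (e := 1 / 2) (by norm_num)),
    eventually_gt_atTop 0] with Λ hcount hΛ c
  have hX : 0 < Λ ^ twoEta d := Real.rpow_pos_of_pos hΛ _
  have hι := iota_pos hd
  have hd0 : (0 : ℝ) < d := by
    have : 0 < d := by omega
    exact_mod_cast this
  obtain ⟨-, hC⟩ := sameSign_propagator hX hκ hσ gap
  have h1 := (abs_le.1 (hcount 1 zero_le_one le_rfl)).2
  have h2 : (latticeCount d (Λ ^ twoEta d) : ℝ) ≤ iota d * (Λ ^ twoEta d) ^ 2 := by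
    rw [one_mul] at h1
    exact (div_le_one (by positivity)).1 (by linarith)
  refine summable_melonicTerm_of_small hd (b := (κ * Λ ^ twoEta d)⁻¹)
    (N := iota d * (Λ ^ twoEta d) ^ 2) (by positivity) (by positivity) ?_ ?_ ?_ c
  · intro q
    by_cases hq : momPow d q ≤ Λ ^ twoEta d
    · rw [propagator_of_mem hq, abs_inv]
      have := (hC q hq).1
      gcongr
    · simp only [propagator, hq, if_false, abs_zero]
      positivity
  · intro c
    rwa [card_slice_zero hd]
  · have h3 : 4 * d * (|2 * coupling d g| * (iota d * (Λ ^ twoEta d) ^ 2) *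
        (κ * Λ ^ twoEta d)⁻¹ ^ 2) = 8 * g / κ ^ 2 := by
      rw [coupling, abs_of_pos (by positivity)]
      field_simp
      ring
    rw [h3]
    exact (div_le_one (by positivity)).2 hgκ

/-! ### The Lambert function -/

theorem hasDerivAt_mul_exp (w : ℝ) :
    HasDerivAt (fun w : ℝ => w * Real.exp w) ((1 + w) * Real.exp w) w := by
  refine ((hasDerivAt_id w).mul (Real.hasDerivAt_exp w)).congr_deriv ?_
  simp only [id]
  ring

theorem monotoneOn_mul_exp : MonotoneOn (fun w : ℝ => w * Real.exp w) (Set.Ici (-1)) := by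
  refine monotoneOn_of_hasDerivWithinAt_nonneg (convex_Ici _)
    (fun w _ => (hasDerivAt_mul_exp w).continuousAt.continuousWithinAt)
    (fun w _ => (hasDerivAt_mul_exp w).hasDerivWithinAt) fun w hw => ?_
  rw [interior_Ici, Set.mem_Ioi] at hw
  exact mul_nonneg (by linarith) (Real.exp_pos w).le

theorem antitoneOn_mul_exp : AntitoneOn (fun w : ℝ => w * Real.exp w) (Set.Iic (-1)) := by
  refine antitoneOn_of_hasDerivWithinAt_nonpos (convex_Iic _)
    (fun w _ => (hasDerivAt_mul_exp w).continuousAt.continuousWithinAt)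
    (fun w _ => (hasDerivAt_mul_exp w).hasDerivWithinAt) fun w hw => ?_
  rw [interior_Iic, Set.mem_Iio] at hw
  exact mul_nonpos_of_nonpos_of_nonneg (by linarith) (Real.exp_pos w).le

theorem lambertW0_spec {x : ℝ} (hx : -Real.exp (-1) ≤ x) :
    -1 ≤ lambertW0 x ∧ lambertW0 x * Real.exp (lambertW0 x) = x := by
  have hex : ∃ w ∈ Set.Ici (-1 : ℝ), w * Real.exp w = x := by
    have hle : (-1 : ℝ) ≤ max x 0 := by linarith [le_max_right x 0]
    have hc : ContinuousOn (fun w : ℝ => w * Real.exp w) (Set.Icc (-1) (max x 0)) := by fun_prop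
    obtain ⟨w, hw, hwx⟩ := intermediate_value_Icc hle hc (show x ∈ Set.Icc _ _ by
      refine ⟨by linarith, ?_⟩
      have h1 : 0 ≤ max x 0 := le_max_right _ _
      have h2 : 1 ≤ Real.exp (max x 0) := Real.one_le_exp h1
      have h3 : x ≤ max x 0 := le_max_left _ _
      nlinarith)
    exact ⟨w, hw.1, hwx⟩
  exact ⟨Function.invFunOn_mem hex, Function.invFunOn_eq hex⟩

theorem lambertWm1_spec {x : ℝ} (hx : -Real.exp (-1) ≤ x) (hx0 : x < 0) :
    lambertWm1 x ≤ -1 ∧ lambertWm1 x * Real.exp (lambertWm1 x) = x := by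
  have hex : ∃ w ∈ Set.Iic (-1 : ℝ), w * Real.exp w = x := by
    have h1 := (Real.tendsto_pow_mul_exp_neg_atTop_nhds_zero 1).eventually_lt_const
      (neg_pos.2 hx0)
    obtain ⟨y, hy, hy1⟩ := (h1.and (eventually_ge_atTop (1 : ℝ))).exists
    have hle : -y ≤ (-1 : ℝ) := by linarith
    have hc : ContinuousOn (fun w : ℝ => w * Real.exp w) (Set.Icc (-y) (-1)) := by fun_prop
    obtain ⟨w, hw, hwx⟩ := intermediate_value_Icc' hle hc (show x ∈ Set.Icc _ _ by
      rw [pow_one] at hy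
      exact ⟨by linarith, by linarith⟩)
    exact ⟨w, hw.2, hwx⟩
  exact ⟨Function.invFunOn_mem hex, Function.invFunOn_eq hex⟩

theorem exponent_eq {g : ℝ} (hg : 0 < g) (μ : ℝ) :
    (1 + μ + 2 * g) / (2 * g) = (1 + μ / (2 * g)) + 1 / (2 * g) := by
  field_simp
  ring

theorem lambertArg_ge {g : ℝ} (hg : 0 < g) (μ : ℝ) : -Real.exp (-1) ≤ lambertArg g μ := by
  set a := 1 + μ / (2 * g) with ha
  have hb : 0 < 1 / (2 * g) := by positivity
  rw [lambertArg, exponent_eq hg, ← ha, add_comm (μ / (2 * g)), ← ha, neg_mul, neg_le_neg_iff]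
  rcases le_total a 0 with h | h
  · exact (mul_nonpos_of_nonpos_of_nonneg h (Real.exp_pos _).le).trans (Real.exp_pos _).le
  · have h1 : a ≤ Real.exp (a - 1) := by linarith [Real.add_one_le_exp (a - 1)]
    calc a * Real.exp (-(a + 1 / (2 * g))) ≤ Real.exp (a - 1) * Real.exp (-a) := by
          gcongr; linarith
      _ = Real.exp (-1) := by rw [← Real.exp_add]; ring_nf

theorem mul_exp_lt_lambertArg {g : ℝ} (hg : 0 < g) (μ : ℝ) :
    -((1 + μ + 2 * g) / (2 * g)) * Real.exp (-((1 + μ + 2 * g) / (2 * g))) < lambertArg g μ := by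
  have hb : 0 < 1 / (2 * g) := by positivity
  rw [lambertArg]
  refine mul_lt_mul_of_pos_right ?_ (Real.exp_pos _)
  linarith [exponent_eq hg μ]

theorem lt_lambertW0 {g : ℝ} (hg : 0 < g) (μ : ℝ) :
    -((1 + μ + 2 * g) / (2 * g)) < lambertW0 (lambertArg g μ) := by
  obtain ⟨h1, h2⟩ := lambertW0_spec (lambertArg_ge hg μ)
  by_contra hc
  push Not at hc
  have h3 := monotoneOn_mul_exp h1 (h1.trans hc) hc
  linarith [mul_exp_lt_lambertArg hg μ]

theorem lambertWm1_lt {g : ℝ} (hg : 0 < g) {μ : ℝ} (h : lambertArg g μ < 0) :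
    lambertWm1 (lambertArg g μ) < -((1 + μ + 2 * g) / (2 * g)) := by
  obtain ⟨h1, h2⟩ := lambertWm1_spec (lambertArg_ge hg μ) h
  by_contra hc
  push Not at hc
  have h3 := antitoneOn_mul_exp (hc.trans h1) h1 hc
  linarith [mul_exp_lt_lambertArg hg μ]

theorem massOfLambert_pos {g μ w : ℝ} (hw : w < -((1 + μ + 2 * g) / (2 * g))) :
    0 < massOfLambert g μ w := by
  have : 1 < Real.exp (-w - (1 + μ + 2 * g) / (2 * g)) := Real.one_lt_exp_iff.2 (by linarith)
  exact inv_pos.2 (by linarith)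

theorem massOfLambert_lt {g μ w : ℝ} (hw : -((1 + μ + 2 * g) / (2 * g)) < w) :
    massOfLambert g μ w < -1 := by
  have h1 : Real.exp (-w - (1 + μ + 2 * g) / (2 * g)) < 1 := Real.exp_lt_one_iff.2 (by linarith)
  have h2 := Real.exp_pos (-w - (1 + μ + 2 * g) / (2 * g))
  rw [massOfLambert, inv_lt_of_neg (by linarith) (by norm_num)]
  norm_num
  exact h2

/-- The mass attached to a value `w` of the Lambert function solves the limit equation. -/
theorem massOfLambert_spec {g μ w : ℝ} (hg : 0 < g)
    (hw : w * Real.exp w = lambertArg g μ) (hne : w ≠ -((1 + μ + 2 * g) / (2 * g))) :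
    massOfLambert g μ w * (2 * g * w + μ + 2 * g) = -(μ + 2 * g) ∧
      massOfLambert g μ w = μ + 2 * g * omegaPrime (massOfLambert g μ w) := by
  set s := (1 + μ + 2 * g) / (2 * g) with hs
  have hs' : 2 * g * s = 1 + μ + 2 * g := by rw [hs]; field_simp
  set x := Real.exp (-w - s) with hx
  have hx1 : x - 1 ≠ 0 := by
    intro h
    have : Real.exp (-w - s) = 1 := by linarith
    rw [Real.exp_eq_one_iff] at this
    exact hne (by linarith)
  have hwx : 2 * g * w = -(μ + 2 * g) * x := by
    have h1 : Real.exp (-s) = x * Real.exp w := by rw [hx, ← Real.exp_add]; ring_nf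
    rw [lambertArg, ← hs, h1, ← mul_assoc] at hw
    have h2 := mul_right_cancel₀ (Real.exp_pos w).ne' hw
    rw [h2]
    field_simp
  have hu : massOfLambert g μ w = (x - 1)⁻¹ := rfl
  have hlog : Real.log ((1 + (x - 1)⁻¹) / (x - 1)⁻¹) = -w - s := by
    have : (1 + (x - 1)⁻¹) / (x - 1)⁻¹ = x := by field_simp; ring
    rw [this, hx, Real.log_exp]
  rw [hu]
  have h1 : (x - 1)⁻¹ * (2 * g * w + μ + 2 * g) = -(μ + 2 * g) := by
    rw [hwx]; field_simp; ring
  refine ⟨h1, ?_⟩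
  rw [omegaPrime, hlog]
  linear_combination -(x - 1)⁻¹ * hs' - h1

theorem lambertArg_neg {g μ : ℝ} (h : 0 < 1 + μ / (2 * g)) : lambertArg g μ < 0 :=
  mul_neg_of_neg_of_pos (by linarith) (Real.exp_pos _)

theorem lambertArg_pos {g μ : ℝ} (h : 1 + μ / (2 * g) < 0) : 0 < lambertArg g μ :=
  mul_pos (by linarith) (Real.exp_pos _)

theorem lambertValue_of_pos {g μ : ℝ} (h : 0 < 1 + μ / (2 * g)) :
    lambertValue g μ = lambertWm1 (lambertArg g μ) := if_pos h

theorem lambertValue_of_nonpos {g μ : ℝ} (h : 1 + μ / (2 * g) ≤ 0) :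
    lambertValue g μ = lambertW0 (lambertArg g μ) := if_neg (not_lt.2 h)

theorem lambertValue_spec {g : ℝ} (hg : 0 < g) (μ : ℝ) :
    lambertValue g μ * Real.exp (lambertValue g μ) = lambertArg g μ ∧
      lambertValue g μ ≠ -((1 + μ + 2 * g) / (2 * g)) := by
  rcases lt_or_ge 0 (1 + μ / (2 * g)) with h | h
  · rw [lambertValue_of_pos h]
    exact ⟨(lambertWm1_spec (lambertArg_ge hg μ) (lambertArg_neg h)).2,
      (lambertWm1_lt hg (lambertArg_neg h)).ne⟩
  · rw [lambertValue_of_nonpos h]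
    exact ⟨(lambertW0_spec (lambertArg_ge hg μ)).2, (lt_lambertW0 hg μ).ne'⟩

theorem uStar_pos {g μ : ℝ} (hg : 0 < g) (h : 0 < 1 + μ / (2 * g)) : 0 < uStar g μ := by
  rw [uStar, lambertValue_of_pos h]
  exact massOfLambert_pos (lambertWm1_lt hg (lambertArg_neg h))

theorem gap_of_pos {μ : ℝ} : ∀ ρ ∈ Set.Icc (0 : ℝ) 1, μ ≤ 1 * (ρ + μ) := fun ρ hρ => by
  linarith [hρ.1]

theorem gap_of_lt {μ : ℝ} : ∀ ρ ∈ Set.Icc (0 : ℝ) 1, -1 - μ ≤ -1 * (ρ + μ) := fun ρ hρ => by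
  linarith [hρ.2]

theorem effectiveMassTendsTo_lambertW0 {g μ : ℝ} (hg : 0 < g) (hμ : μ < -1) :
    EffectiveMassTendsTo g μ (massOfLambert g μ (lambertW0 (lambertArg g μ))) := by
  refine effectiveMassTendsTo_of_fixed_point hg (κ := -1 - μ) (by linarith) (by simp) gap_of_lt
    (D := Set.Iio (-1)) (omegaPrime_antitoneOn (convex_Iio _) fun x hx => ?_)
    (massOfLambert_lt (lt_lambertW0 hg μ)) (fun x hx => ?_)
    (massOfLambert_spec hg (lambertW0_spec (lambertArg_ge hg μ)).2 (lt_lambertW0 hg μ).ne').2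
  · rw [Set.mem_Iio] at hx
    exact div_pos_of_neg_of_neg (by linarith) (by linarith)
  · rw [Set.mem_Iio]
    linarith

theorem effectiveMassTendsTo_uStar {g μ : ℝ} (hg : 0 < g) (hμ : 0 < μ) :
    EffectiveMassTendsTo g μ (uStar g μ) := by
  refine effectiveMassTendsTo_of_fixed_point hg (κ := μ) hμ (by simp) gap_of_pos
    (D := Set.Ioi 0) (omegaPrime_antitoneOn (convex_Ioi _) fun x hx => ?_)
    (uStar_pos hg (by positivity)) (fun x hx => ?_)
    (massOfLambert_spec hg (lambertValue_spec hg μ).1 (lambertValue_spec hg μ).2).2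
  · rw [Set.mem_Ioi] at hx
    positivity
  · rw [Set.mem_Ioi]
    linarith

end TGFT

theorem proposition3 :
    -- the melonic expansion converges at small coupling, uniformly in the rank
    (∀ μ : ℝ, (0 < μ ∨ μ < -1) → ∃ g₀ : ℝ, 0 < g₀ ∧ ∀ g : ℝ, 0 < g → g < g₀ →
      ∀ᶠ d : ℕ in Filter.atTop, ∀ᶠ Λ : ℝ in Filter.atTop, ∀ c : Fin d,
        TGFT.MelonicSeriesConverges d Λ g μ c) ∧
    -- the effective mass goes to `u⋆`, the branch being given by the sign of `1 + μ/2g`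
    (∀ g μ : ℝ, 0 < g → (0 < μ ∨ (μ < -1 ∧ 1 + μ / (2 * g) < 0)) →
      TGFT.EffectiveMassTendsTo g μ (TGFT.uStar g μ)) ∧
    -- the branch `W₀` persists for masses `μ < -1` at stronger coupling
    (∀ g μ : ℝ, 0 < g → μ < -1 → 0 ≤ 1 + μ / (2 * g) →
      TGFT.EffectiveMassTendsTo g μ
        (TGFT.massOfLambert g μ (TGFT.lambertW0 (TGFT.lambertArg g μ)))) ∧
    -- the closed form, for each sign of `1 + μ/2g`
    (∀ g μ : ℝ, 0 < g → 0 < 1 + μ / (2 * g) →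
      -Real.exp (-1) ≤ TGFT.lambertArg g μ ∧ TGFT.lambertArg g μ < 0 ∧
      TGFT.lambertValue g μ ≤ -1 ∧ 0 < TGFT.uStar g μ) ∧
    (∀ g μ : ℝ, 0 < g → 1 + μ / (2 * g) < 0 →
      0 < TGFT.lambertArg g μ ∧ -1 ≤ TGFT.lambertValue g μ ∧ TGFT.uStar g μ < -1) ∧
    (∀ g μ : ℝ, 0 < g → 1 + μ / (2 * g) ≠ 0 →
      TGFT.lambertValue g μ * Real.exp (TGFT.lambertValue g μ) = TGFT.lambertArg g μ ∧
      2 * g * TGFT.lambertValue g μ + μ + 2 * g ≠ 0 ∧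
      TGFT.uStar g μ = -(μ + 2 * g) / (2 * g * TGFT.lambertValue g μ + μ + 2 * g) ∧
      ∃ z : ℝ, TGFT.uStar g μ = μ + z ∧ z = 2 * g * TGFT.omegaPrime (μ + z)) := by
  refine ⟨fun μ hμ => ?_, fun g μ hg hμ => ?_, fun g μ hg hμ _ => ?_, fun g μ hg h => ?_,
    fun g μ hg h => ?_, fun g μ hg h => ?_⟩
  · rcases hμ with hμ | hμ
    · exact ⟨μ ^ 2 / 8, by positivity, fun g hg hg' =>
        TGFT.melonicSeriesConverges_of_small hg (by linarith) hμ (by simp) TGFT.gap_of_pos⟩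
    · have hκ : 0 < -1 - μ := by linarith
      exact ⟨(-1 - μ) ^ 2 / 8, by positivity, fun g hg hg' =>
        TGFT.melonicSeriesConverges_of_small hg (by linarith) hκ (by simp) TGFT.gap_of_lt⟩
  · rcases hμ with hμ | ⟨hμ, h⟩
    · exact TGFT.effectiveMassTendsTo_uStar hg hμ
    · rw [TGFT.uStar, TGFT.lambertValue_of_nonpos h.le]
      exact TGFT.effectiveMassTendsTo_lambertW0 hg hμ
  · exact TGFT.effectiveMassTendsTo_lambertW0 hg hμ
  · refine ⟨TGFT.lambertArg_ge hg μ, TGFT.lambertArg_neg h, ?_, TGFT.uStar_pos hg h⟩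
    rw [TGFT.lambertValue_of_pos h]
    exact (TGFT.lambertWm1_spec (TGFT.lambertArg_ge hg μ) (TGFT.lambertArg_neg h)).1
  · rw [TGFT.uStar, TGFT.lambertValue_of_nonpos h.le]
    exact ⟨TGFT.lambertArg_pos h, (TGFT.lambertW0_spec (TGFT.lambertArg_ge hg μ)).1,
      TGFT.massOfLambert_lt (TGFT.lt_lambertW0 hg μ)⟩
  · obtain ⟨h1, h2⟩ := TGFT.lambertValue_spec hg μ
    obtain ⟨h3, h4⟩ := TGFT.massOfLambert_spec hg h1 h2
    have h5 : μ + 2 * g ≠ 0 := by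
      intro h0
      apply h
      field_simp
      linarith
    have h6 : 2 * g * TGFT.lambertValue g μ + μ + 2 * g ≠ 0 := by
      intro h0
      rw [h0, mul_zero] at h3
      exact h5 (by linarith)
    refine ⟨h1, h6, (eq_div_iff h6).2 h3, 2 * g * TGFT.omegaPrime (TGFT.uStar g μ), h4, ?_⟩
    have h7 : μ + 2 * g * TGFT.omegaPrime (TGFT.uStar g μ) = TGFT.uStar g μ := h4.symm
    rw [h7]
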